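/- Let $\mathcal D$ be a distribution over convex functions $\psi:\mathbb R^d\to\mathbb R$ with $\psi(x)$ integrable for every $x$, let $f(x)=\mathbb E_{\psi\sim\mathcal D}[\psi(x)]$ be twice continuously differentiable, and let $\mu,\lambda>0$, $\kappa=\lambda/\mu$. Assume that $f$ is $\mu$-strongly convex, i.e. $f(x)\ge f(x')+\nabla f(x')^\top(x-x')+\frac\mu2\|x-x'\|^2$ for all $x,x'$, and that almost surely $\psi$ is differentiable and $\lambda$-smooth, i.e. $\psi(x)\le\psi(x')+\nabla\psi(x')^\top(x-x')+\frac\lambda2\|x-x'\|^2$ for all $x,x'$. Let $x^*$ be the minimizer of $f$, $H=\nabla^2f(x^*)$ and $\|v\|_H=\sqrt{v^\top Hv}$. Assume further that one of the following holds, and define $U_f(\epsilon)$ for $\epsilon\in(0,1)$ accordingly: (a) $f$ is self-concordant: it is three times differentiable and, for all $x,v\in\mathbb R^d$, $\phi(t)=f(x+tv)$ satisfies $|\phi'''(t)|\le2\phi''(t)^{3/2}$ for all $t$; then $U_f(\epsilon)=\{x:\|x-x^*\|_H<\epsilon/4\}$; (b) $f$ has a Lipschitz Hessian with a constant $L\ge0$: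 $\|\nabla^2f(x)-\nabla^2f(x')\|\le L\|x-x'\|$ for all $x,x'$; then $U_f(\epsilon)=\{x:L\,\|x-x^*\|_H<\epsilon\,\mu^{3/2}\}$. There is an absolute constant $c>0$ (independent of $d$, $\mathcal D$, $\mu$, $\lambda$, $L$ and of all quantities below) such that the following holds for every $\epsilon_H\in(0,1/4]$. The set $U_f(\epsilon_H)$ is a neighborhood of $x^*$. Let $\tilde x_s\in U_f(\epsilon_H)$, let $\tilde g_s=\nabla f(\tilde x_s)$, and let $\tilde B_s$ satisfy $(1-\epsilon_H)\nabla^2f(\tilde x_s)^{-1}\preceq\tilde B_s\preceq(1+\epsilon_H)\nabla^2f(\tilde x_s)^{-1}$ in the positive semidefinite order. Let $\delta\in(0,1)$ and let $t\ge1$, $m$ be integers with $t/\delta\ge2$ (which is automatic if $t\ge2$ or $\delta\le1/2$), $t\ge\frac{\log(m/\kappa)}{\log(1/(3\epsilon_H))}$ and $m\ge c\,\kappa\log(t/\delta)$. Starting from $x_0=\tilde x_s$, run $$x_{k+1}=x_k-\tilde B_s\Big(\frac1m\sum_{i=1}^m\big(\nabla\psi_{k,i}(x_k)-\nabla\psi_{k,i}(\tilde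 x_s)\big)+\tilde g_s\Big),\qquad k=0,1,\dots,t-1,$$ where all the $\psi_{k,i}$ are independent with distribution $\mathcal D$ (a fresh mini-batch in every step). Then, with probability at least $1-\delta$, $\tilde x_{s+1}=x_t$ satisfies $$f(\tilde x_{s+1})-f(x^*)\le\rho\,\big(f(\tilde x_s)-f(x^*)\big)\quad\text{and}\quad\tilde x_{s+1}\in U_f(\sqrt\rho\,\epsilon_H),\qquad\text{where }\rho=c\log(t/\delta)\,\frac\kappa m.$$ -/

import Mathlib

open MeasureTheory ProbabilityTheory Topology

/-- `ℝ^d` with the Euclidean norm. -/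
abbrev RVec (d : ℕ) : Type := EuclideanSpace ℝ (Fin d)

/-- The Hessian `∇²f(x)`, as a linear operator on `ℝ^d` (the derivative of the gradient). -/
noncomputable def hess {d : ℕ} (f : RVec d → ℝ) (x : RVec d) : RVec d →L[ℝ] RVec d :=
  fderiv ℝ (gradient f) x

/-- The norm `‖v‖_A = √(vᵀ A v)`. -/
noncomputable def normWrt {d : ℕ} (A : RVec d →L[ℝ] RVec d) (v : RVec d) : ℝ :=
  Real.sqrt (inner ℝ v (A v))

/-- `μ`-strong convexity of a differentiable function `f`. -/
def IsStronglyConvex {d : ℕ} (μ : ℝ) (f : RVec d → ℝ) : Prop :=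
  ∀ x x' : RVec d,
    f x' + inner ℝ (gradient f x') (x - x') + μ / 2 * ‖x - x'‖ ^ 2 ≤ f x

/-- `lam`-smoothness: `ψ` is differentiable and lies below its quadratic upper models. -/
def IsSmooth {d : ℕ} (lam : ℝ) (ψ : RVec d → ℝ) : Prop :=
  Differentiable ℝ ψ ∧ ∀ x x' : RVec d,
    ψ x ≤ ψ x' + inner ℝ (gradient ψ x') (x - x') + lam / 2 * ‖x - x'‖ ^ 2

/-- Self-concordance: `f` is three times differentiable and its restriction
`φ(t) = f(x + t v)` to any line satisfies `|φ'''| ≤ 2 (φ'')^(3/2)`. -/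
def IsSelfConcordant {d : ℕ} (f : RVec d → ℝ) : Prop :=
  ContDiff ℝ 2 f ∧ Differentiable ℝ (hess f) ∧ ∀ (x v : RVec d) (t : ℝ),
    |iteratedDeriv 3 (fun s : ℝ => f (x + s • v)) t| ≤
      2 * (iteratedDeriv 2 (fun s : ℝ => f (x + s • v)) t) ^ (3 / 2 : ℝ)

/-- The Hessian of `f` is Lipschitz with constant `L` in the operator (spectral) norm. -/
def HasLipschitzHessian {d : ℕ} (L : ℝ) (f : RVec d → ℝ) : Prop :=
  ∀ x x' : RVec d, ‖hess f x - hess f x'‖ ≤ L * ‖x - x'‖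

/-- The local neighborhood `U_f(ε)` of the minimizer `xs` for a self-concordant `f`. -/
def nbhdSelfConcordant {d : ℕ} (f : RVec d → ℝ) (xs : RVec d) (ε : ℝ) : Set (RVec d) :=
  {x | normWrt (hess f xs) (x - xs) < ε / 4}

/-- The local neighborhood `U_f(ε)` of the minimizer `xs` for a `μ`-strongly convex `f` with
`L`-Lipschitz Hessian: `‖x - xs‖_H < ε μ^(3/2) / L`, written without division, so that it is the
whole space when `L = 0`. -/
def nbhdLipschitz {d : ℕ} (μ L : ℝ) (f : RVec d → ℝ) (xs : RVec d) (ε : ℝ) : Set (RVec d) :=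
  {x | L * normWrt (hess f xs) (x - xs) < ε * μ ^ (3 / 2 : ℝ)}

/-- `(1 - ε) A⁻¹ ≼ B ≼ (1 + ε) A⁻¹` in the positive semidefinite order, for an invertible `A`. -/
def IsInverseApprox {d : ℕ} (ε : ℝ) (A B : RVec d →L[ℝ] RVec d) : Prop :=
  (B - (1 - ε) • A.inverse).IsPositive ∧ ((1 + ε) • A.inverse - B).IsPositive

/-- The inner iterates `x_0, x_1, …` of SVRN started at `x0`, with Hessian inverse estimate `B`,
full gradient `g` at `x0`, and mini-batch `ψ (ζ k 0), …, ψ (ζ k (m - 1))` in step `k`. -/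
noncomputable def svrnIterate {d m : ℕ} {Z : Type*} (ψ : Z → RVec d → ℝ)
    (B : RVec d →L[ℝ] RVec d) (g x0 : RVec d) (ζ : ℕ → Fin m → Z) : ℕ → RVec d
  | 0 => x0
  | k + 1 =>
      svrnIterate ψ B g x0 ζ k - B ((1 / (m : ℝ)) • ∑ i : Fin m,
        (gradient (ψ (ζ k i)) (svrnIterate ψ B g x0 ζ k) - gradient (ψ (ζ k i)) x0) + g)

/-! Write `A` for the Hessian at `xt`, `Δ` for the `A`-distance from `xt` to `xs`, and `η = √(κ
log(t/δ)/m)`. On the neighborhood the gradient equals `A (x - xs)` up to a relative error `3ε/2` in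
the dual `A`-norm (`IsLocalModel`). A step preconditioned by `B` is thus an inexact Newton step: it
multiplies the `A`-distance to `xs` by less than `3ε` and adds the mini-batch noise
(`normWrt_newton_step_le`, `IsLocalModel.iterate_le`). Noise of order `η Δ` per step sums
geometrically, so `t` steps leave a distance of at most `((3ε)^t + 40η) Δ`, and the condition on `t`
makes `(3ε)^t ≤ η`. Function gaps are comparable to squared `A`-distances, so the gap shrinks by a
factor of order `η²`, which is the order of `ρ`.

The noise is of order `η Δ` because convexity and smoothness make the sample gradients cocoercive:
the variance of a gradient difference is at most `λ ⟨∇f x - ∇f xt, x - xt⟩ = O(λ Δ²)`. Lipschitz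
continuity alone would cost another factor `κ`. A Bernstein inequality free of the dimension, proved
through `cosh ‖·‖` (`measureReal_norm_sum_ge_le`), turns this into a tail bound at each fixed point.
A fresh batch is independent of the current iterate, so the bound carries over to random iterates,
and a union bound over `t` steps finishes.

In the self-concordant case the hypothesis controls the third derivative only on the diagonal;
`abs_cubic_polar_le` extends it to mixed directions with the same constant. -/

/-! ### Operator norms `‖·‖_A` and inexact Newton steps -/

section SemiNorm

variable {d : ℕ}

theorem normWrt_nonneg (A : RVec d →L[ℝ] RVec d) (v : RVec d) : 0 ≤ normWrt A v :=
  Real.sqrt_nonneg _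

theorem normWrt_sq {A : RVec d →L[ℝ] RVec d} (hA : ∀ v, 0 ≤ inner ℝ v (A v)) (v : RVec d) :
    normWrt A v ^ 2 = inner ℝ v (A v) :=
  Real.sq_sqrt (hA v)

theorem normWrt_zero (A : RVec d →L[ℝ] RVec d) : normWrt A 0 = 0 := by
  simp [normWrt]

theorem continuous_normWrt (A : RVec d →L[ℝ] RVec d) : Continuous (normWrt A) := by
  unfold normWrt
  fun_prop

theorem normWrt_smul (A : RVec d →L[ℝ] RVec d) {s : ℝ} (hs : 0 ≤ s) (v : RVec d) :
    normWrt A (s • v) = s * normWrt A v := by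
  unfold normWrt
  rw [map_smul, inner_smul_left, inner_smul_right, ← mul_assoc]
  simp only [conj_trivial]
  rw [Real.sqrt_mul (mul_self_nonneg s), Real.sqrt_mul_self hs]

theorem normWrt_sub_comm (A : RVec d →L[ℝ] RVec d) (u v : RVec d) :
    normWrt A (u - v) = normWrt A (v - u) := by
  unfold normWrt
  rw [← neg_sub v u, map_neg, inner_neg_neg]

/-- A symmetric operator whose quadratic form is dominated by that of `P` has a bilinear form
dominated by the product of the `P`-norms. -/
theorem abs_inner_le_of_quadratic {T P : RVec d →L[ℝ] RVec d} {α : ℝ} (hα : 0 ≤ α)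
    (hT : ∀ u v, inner ℝ (T u) v = inner ℝ u (T v))
    (hP : ∀ v, 0 ≤ inner ℝ v (P v))
    (h : ∀ v, |inner ℝ v (T v)| ≤ α * inner ℝ v (P v)) (v w : RVec d) :
    |inner ℝ v (T w)| ≤ α * normWrt P v * normWrt P w := by
  have hsym : inner ℝ w (T v) = inner ℝ v (T w) := by rw [← hT, real_inner_comm]
  -- Comparing the hypothesis at `s • v + w` and at `s • v - w` leaves a quadratic in `s` that is
  -- never negative; its discriminant gives the claim.
  have key : ∀ s : ℝ, 0 ≤ (α * inner ℝ v (P v)) * (s * s) + (-2 * inner ℝ v (T w)) * s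
      + α * inner ℝ w (P w) := by
    intro s
    have h1 := (abs_le.1 (h (s • v + w))).2
    have h2 := (abs_le.1 (h (s • v - w))).1
    simp only [map_add, map_sub, map_smul, inner_add_left, inner_add_right, inner_sub_left,
      inner_sub_right, inner_smul_left, inner_smul_right, conj_trivial, hsym] at h1 h2
    nlinarith
  have hd := discrim_le_zero key
  unfold discrim at hd
  have hsq : (inner ℝ v (T w)) ^ 2 ≤ (α * normWrt P v * normWrt P w) ^ 2 := by
    rw [mul_pow, mul_pow, normWrt_sq hP, normWrt_sq hP]
    nlinarith
  exact abs_le_of_sq_le_sq hsq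
    (mul_nonneg (mul_nonneg hα (normWrt_nonneg _ _)) (normWrt_nonneg _ _))

theorem abs_inner_le_normWrt {P : RVec d →L[ℝ] RVec d}
    (hT : ∀ u v, inner ℝ (P u) v = inner ℝ u (P v))
    (hP : ∀ v, 0 ≤ inner ℝ v (P v)) (v w : RVec d) :
    |inner ℝ v (P w)| ≤ normWrt P v * normWrt P w := by
  have := abs_inner_le_of_quadratic (α := 1) zero_le_one hT hP
    (fun v => by rw [abs_of_nonneg (hP v), one_mul]) v w
  rwa [one_mul] at this

theorem normWrt_add_le {P : RVec d →L[ℝ] RVec d}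
    (hT : ∀ u v, inner ℝ (P u) v = inner ℝ u (P v))
    (hP : ∀ v, 0 ≤ inner ℝ v (P v)) (v w : RVec d) :
    normWrt P (v + w) ≤ normWrt P v + normWrt P w := by
  refine le_of_sq_le_sq ?_ (add_nonneg (normWrt_nonneg _ _) (normWrt_nonneg _ _))
  have h1 := (abs_le.1 (abs_inner_le_normWrt hT hP v w)).2
  have hsym : inner ℝ w (P v) = inner ℝ v (P w) := by rw [← hT, real_inner_comm]
  rw [add_sq, normWrt_sq hP, normWrt_sq hP, normWrt_sq hP]
  simp only [map_add, inner_add_left, inner_add_right, hsym]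
  linarith

theorem mul_norm_le_normWrt {P : RVec d →L[ℝ] RVec d} {μ : ℝ}
    (hP : ∀ v, μ * ‖v‖ ^ 2 ≤ inner ℝ v (P v)) (v : RVec d) :
    √μ * ‖v‖ ≤ normWrt P v := by
  unfold normWrt
  rw [← Real.sqrt_sq (norm_nonneg v), ← Real.sqrt_mul' _ (sq_nonneg _)]
  exact Real.sqrt_le_sqrt (hP v)

theorem isInvertible_of_coercive {A : RVec d →L[ℝ] RVec d} {μ : ℝ} (hμ : 0 < μ)
    (hA : ∀ v, μ * ‖v‖ ^ 2 ≤ inner ℝ v (A v)) : A.IsInvertible := by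
  have hinj : Function.Injective (A : RVec d →ₗ[ℝ] RVec d) := by
    rw [← LinearMap.ker_eq_bot, LinearMap.ker_eq_bot']
    intro v hv
    have h1 := hA v
    have h2 : A v = 0 := hv
    rw [h2, inner_zero_right] at h1
    have h3 : ‖v‖ ^ 2 ≤ 0 := nonpos_of_mul_nonpos_right h1 hμ
    simpa using le_antisymm h3 (sq_nonneg _)
  refine ⟨(LinearEquiv.ofInjectiveEndo (A : RVec d →ₗ[ℝ] RVec d) hinj).toContinuousLinearEquiv, ?_⟩
  ext v
  rfl

/-- One inexact Newton step contracts the `A`-norm. -/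
theorem normWrt_newton_step_le {A B : RVec d →L[ℝ] RVec d} {μ ε b : ℝ} (hμ : 0 < μ) (hε : 0 < ε)
    (hs : ∀ u v, inner ℝ (A u) v = inner ℝ u (A v))
    (hA : ∀ v, μ * ‖v‖ ^ 2 ≤ inner ℝ v (A v)) (hB : IsInverseApprox ε A B)
    (w p : RVec d) (hb : 0 ≤ b) (hp : ∀ v, |inner ℝ v p| ≤ b * normWrt A v) :
    normWrt A (w - B (A w + p)) ≤ ε * normWrt A w + (1 + ε) * b := by
  have hA0 : ∀ v, 0 ≤ inner ℝ v (A v) := fun v =>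
    (mul_nonneg hμ.le (sq_nonneg _)).trans (hA v)
  have hinv := isInvertible_of_coercive hμ hA
  set Ai := A.inverse with hAi
  have hl : ∀ v, Ai (A v) = v := hinv.inverse_apply_self
  have hr : ∀ v, A (Ai v) = v := hinv.self_apply_inverse
  have his : ∀ u v, inner ℝ (Ai u) v = inner ℝ u (Ai v) := by
    intro u v
    conv_lhs => rw [← hr v]
    conv_rhs => rw [← hr u]
    rw [hs]
  have hi0 : ∀ v, 0 ≤ inner ℝ v (Ai v) := by
    intro v
    conv_rhs => rw [← hr v]
    rw [hl, hs]
    exact hA0 _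
  have hN : ∀ v, normWrt Ai (A v) = normWrt A v := by
    intro v
    unfold normWrt
    rw [hl, hs]
  obtain ⟨hB1, hB2⟩ := hB
  rw [← hAi] at hB1 hB2
  have hBs : ∀ u v, inner ℝ (B u) v = inner ℝ u (B v) := by
    intro u v
    have h1 := hB1.isSymmetric u v
    simp only [ContinuousLinearMap.coe_coe, _root_.sub_apply,
      _root_.smul_apply, inner_sub_left, inner_sub_right, inner_smul_left,
      inner_smul_right, conj_trivial, his] at h1
    linarith
  have hT : ∀ u v, |inner ℝ u ((Ai - B) v)| ≤ ε * normWrt Ai u * normWrt Ai v := by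
    refine abs_inner_le_of_quadratic hε.le ?_ hi0 ?_
    · intro u v
      simp only [_root_.sub_apply, inner_sub_left, inner_sub_right, his, hBs]
    · intro v
      have h1 := hB1.inner_nonneg_right v
      have h2 := hB2.inner_nonneg_right v
      simp only [_root_.sub_apply, _root_.smul_apply, inner_sub_right,
        inner_smul_right] at h1 h2 ⊢
      rw [abs_le]
      constructor <;> linarith
  have hcontr : ∀ u, normWrt A (u - B (A u)) ≤ ε * normWrt A u := by
    intro u
    -- For `q = u - B (A u) = (Ai - B) (A u)`, pairing with `A q` produces `‖q‖_A ^ 2`, and one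
    -- factor cancels.
    have h1 := (abs_le.1 (hT (A (u - B (A u))) (A u))).2
    rw [_root_.sub_apply, hl, hN, hN, hs, ← normWrt_sq hA0] at h1
    by_contra hcon
    push Not at hcon
    have h4 : 0 < normWrt A (u - B (A u)) :=
      lt_of_le_of_lt (mul_nonneg hε.le (normWrt_nonneg _ _)) hcon
    nlinarith
  have hBA : ∀ u, normWrt A (B (A u)) ≤ (1 + ε) * normWrt A u := by
    intro u
    have h1 := normWrt_add_le hs hA0 u (B (A u) - u)
    rw [normWrt_sub_comm, add_sub_cancel] at h1
    have := hcontr u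
    linarith
  have hBp : normWrt A (B p) ≤ (1 + ε) * b := by
    -- The test vector `B A B p` pairs with `p` to `‖B p‖_A ^ 2`, and its own norm is controlled by
    -- `hBA`.
    have h1 := (abs_le.1 (hp (B (A (B p))))).2
    rw [hBs, hs, ← normWrt_sq hA0] at h1
    have h2 := hBA (B p)
    have h3 : b * normWrt A (B (A (B p))) ≤ b * ((1 + ε) * normWrt A (B p)) :=
      mul_le_mul_of_nonneg_left h2 hb
    by_contra hcon
    push Not at hcon
    have h4 : 0 < normWrt A (B p) := lt_of_le_of_lt (by positivity) hcon
    nlinarith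
  have h1 := normWrt_add_le hs hA0 (w - B (A w)) (0 - B p)
  rw [normWrt_sub_comm A 0, sub_zero] at h1
  have h2 : w - B (A w + p) = w - B (A w) + (0 - B p) := by
    rw [map_add]; abel
  rw [h2]
  have := hcontr w
  linarith

end SemiNorm

/-! ### Polarization of cubic forms in the plane -/

/-- The norm of a symmetric cubic form on a plane is attained on the diagonal. -/
theorem abs_cubic_polar_le {t0 t1 t2 t3 M : ℝ}
    (h : ∀ a b : ℝ, a ^ 2 + b ^ 2 = 1 →
      |a ^ 3 * t0 + 3 * a ^ 2 * b * t1 + 3 * a * b ^ 2 * t2 + b ^ 3 * t3| ≤ M) (x y : ℝ) :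
    |x * t0 + y * t1| ≤ M * √(x ^ 2 + y ^ 2) := by
  set z : ℂ := ⟨x, y⟩ with hz
  have hnorm : ‖z‖ = √(x ^ 2 + y ^ 2) := by
    rw [Complex.norm_def, Complex.normSq_apply]; simp [hz, sq]
  rw [← hnorm]
  set γ := Complex.arg z / 3 with hγ
  set a := Real.cos γ with ha
  set b := Real.sin γ with hb
  have h1 : a ^ 2 + b ^ 2 = 1 := Real.cos_sq_add_sin_sq γ
  have h3 : 3 * γ = Complex.arg z := by rw [hγ]; ring
  have hx : x = ‖z‖ * (4 * a ^ 3 - 3 * a) := by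
    rw [ha, ← Real.cos_three_mul, h3, Complex.norm_mul_cos_arg]
  have hy : y = ‖z‖ * (3 * b - 4 * b ^ 3) := by
    rw [hb, ← Real.sin_three_mul, h3, Complex.norm_mul_sin_arg]
  -- Substituting `b = √3 β` removes the radicals from rotations by `±2π/3`.
  obtain ⟨s, hs0, hs⟩ : ∃ s : ℝ, 0 < s ∧ s ^ 2 = 3 :=
    ⟨√3, by positivity, Real.sq_sqrt (by norm_num)⟩
  obtain ⟨β, hβ⟩ : ∃ β, b = s * β := ⟨b / s, by field_simp⟩
  clear_value a b
  subst hβ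
  have hs3 : s ^ 3 = 3 * s := by linear_combination s * hs
  have h1' : a ^ 2 + 3 * β ^ 2 = 1 := by linear_combination h1 - β ^ 2 * hs
  have h' : ∀ a b : ℝ, a ^ 2 + 3 * b ^ 2 = 1 →
      |a ^ 3 * t0 + 3 * a ^ 2 * b * (s * t1) + 3 * a * b ^ 2 * (3 * t2)
        + b ^ 3 * (3 * s * t3)| ≤ M := by
    intro a b hab
    refine le_of_eq_of_le (congrArg _ ?_) (h a (s * b) (by linear_combination hab + b ^ 2 * hs))
    linear_combination (-3 * a * b ^ 2 * t2) * hs - b ^ 3 * t3 * hs3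
  -- The three test points are `(a, b)` and its rotations by `±2π/3`, the complex cube roots of the
  -- direction of `z`.
  have p0 := h' a β h1'
  have p1 := h' (-a / 2 - 3 / 2 * β) (a / 2 - β / 2) (by linear_combination h1')
  have p2 := h' (-a / 2 + 3 / 2 * β) (-a / 2 - β / 2) (by linear_combination h1')
  -- These are the weights of a convex combination: averaging the cubic over the three points with
  -- them cancels `t2` and `t3` and leaves `(x t0 + y t1) / ‖z‖` when `z ≠ 0`.
  have hsum : (a ^ 2 - β ^ 2) ^ 2 + 4 * β ^ 2 * (a + β) ^ 2 + 4 * β ^ 2 * (a - β) ^ 2 = 1 := by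
    linear_combination (a ^ 2 + 3 * β ^ 2 + 1) * h1'
  generalize hu1 : s * t1 = u1 at *
  generalize 3 * t2 = u2 at *
  generalize 3 * s * t3 = u3 at *
  have e0 : (a ^ 3 - 9 * a * β ^ 2) * t0 + (3 * a ^ 2 * β - 3 * β ^ 3) * u1 =
      (a ^ 2 - β ^ 2) ^ 2 * (a ^ 3 * t0 + 3 * a ^ 2 * β * u1 + 3 * a * β ^ 2 * u2 + β ^ 3 * u3)
      + 4 * β ^ 2 * (a + β) ^ 2 * ((-a / 2 - 3 / 2 * β) ^ 3 * t0
        + 3 * (-a / 2 - 3 / 2 * β) ^ 2 * (a / 2 - β / 2) * u1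
        + 3 * (-a / 2 - 3 / 2 * β) * (a / 2 - β / 2) ^ 2 * u2 + (a / 2 - β / 2) ^ 3 * u3)
      + 4 * β ^ 2 * (a - β) ^ 2 * ((-a / 2 + 3 / 2 * β) ^ 3 * t0
        + 3 * (-a / 2 + 3 / 2 * β) ^ 2 * (-a / 2 - β / 2) * u1
        + 3 * (-a / 2 + 3 / 2 * β) * (-a / 2 - β / 2) ^ 2 * u2
        + (-a / 2 - β / 2) ^ 3 * u3) := by
    have h2 : (a ^ 2 + 3 * β ^ 2) ^ 2 = 1 := by rw [h1', one_pow]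
    calc _ = ((a ^ 3 - 9 * a * β ^ 2) * t0 + (3 * a ^ 2 * β - 3 * β ^ 3) * u1)
            * (a ^ 2 + 3 * β ^ 2) ^ 2 := by rw [h2, mul_one]
      _ = _ := by ring
  have hrep : x * t0 + y * t1 =
      ‖z‖ * ((a ^ 3 - 9 * a * β ^ 2) * t0 + (3 * a ^ 2 * β - 3 * β ^ 3) * u1) := by
    have e1 : 4 * a ^ 3 - 3 * a = a ^ 3 - 9 * a * β ^ 2 := by linear_combination 3 * a * h1'
    have e2 : (3 * (s * β) - 4 * (s * β) ^ 3) * t1 = (3 * a ^ 2 * β - 3 * β ^ 3) * u1 := by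
      rw [← hu1]
      linear_combination -4 * β ^ 3 * t1 * hs3 - 3 * s * β * t1 * h1'
    rw [← e1, mul_add, ← e2]
    linear_combination t0 * hx + t1 * hy
  rw [hrep, e0, abs_mul, abs_of_nonneg (norm_nonneg z), mul_comm M]
  refine mul_le_mul_of_nonneg_left ?_ (norm_nonneg z)
  clear e0 hrep hx hy
  generalize a ^ 3 * t0 + 3 * a ^ 2 * β * u1 + 3 * a * β ^ 2 * u2 + β ^ 3 * u3 = q0 at *
  generalize (-a / 2 - 3 / 2 * β) ^ 3 * t0 + 3 * (-a / 2 - 3 / 2 * β) ^ 2 * (a / 2 - β / 2) * u1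
    + 3 * (-a / 2 - 3 / 2 * β) * (a / 2 - β / 2) ^ 2 * u2 + (a / 2 - β / 2) ^ 3 * u3 = q1 at *
  generalize (-a / 2 + 3 / 2 * β) ^ 3 * t0 + 3 * (-a / 2 + 3 / 2 * β) ^ 2 * (-a / 2 - β / 2) * u1
    + 3 * (-a / 2 + 3 / 2 * β) * (-a / 2 - β / 2) ^ 2 * u2 + (-a / 2 - β / 2) ^ 3 * u3 = q2 at *
  have c0 : 0 ≤ (a ^ 2 - β ^ 2) ^ 2 := by positivity
  have c1 : 0 ≤ 4 * β ^ 2 * (a + β) ^ 2 := by positivity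
  have c2 : 0 ≤ 4 * β ^ 2 * (a - β) ^ 2 := by positivity
  calc _ ≤ |(a ^ 2 - β ^ 2) ^ 2 * q0| + |4 * β ^ 2 * (a + β) ^ 2 * q1|
        + |4 * β ^ 2 * (a - β) ^ 2 * q2| := abs_add_three _ _ _
    _ = (a ^ 2 - β ^ 2) ^ 2 * |q0| + 4 * β ^ 2 * (a + β) ^ 2 * |q1|
        + 4 * β ^ 2 * (a - β) ^ 2 * |q2| := by
      rw [abs_mul, abs_mul (_ * _) q1, abs_mul (_ * _) q2, abs_of_nonneg c0, abs_of_nonneg c1,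
        abs_of_nonneg c2]
    _ ≤ (a ^ 2 - β ^ 2) ^ 2 * M + 4 * β ^ 2 * (a + β) ^ 2 * M
        + 4 * β ^ 2 * (a - β) ^ 2 * M := by gcongr
    _ = M := by linear_combination M * hsum

/-! ### The Hessian as derivative of the gradient -/

section Hessian

variable {d : ℕ} {f : RVec d → ℝ}

theorem hasFDerivAt_gradient (hf : ContDiff ℝ 2 f) (x : RVec d) :
    HasFDerivAt (gradient f) (hess f x) x := by
  have h : ContDiff ℝ 1 (gradient f) := by
    rw [contDiff_euclidean]
    intro i
    have h1 : (fun x => gradient f x i) = fun x => fderiv ℝ f x (EuclideanSpace.single i 1) := by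
      ext y
      rw [← inner_gradient_left, EuclideanSpace.inner_single_right]
      simp
    rw [h1]
    exact (hf.fderiv_right (m := 1) (by norm_num)).clm_apply contDiff_const
  exact (h.differentiable (by norm_num) x).hasFDerivAt

theorem hasDerivAt_line (x v : RVec d) (t : ℝ) : HasDerivAt (fun s : ℝ => x + s • v) v t := by
  simpa using ((hasDerivAt_id t).smul_const v).const_add x

theorem hasDerivAt_gradient_line (hf : ContDiff ℝ 2 f) (x v : RVec d) (t : ℝ) :
    HasDerivAt (fun s : ℝ => gradient f (x + s • v)) (hess f (x + t • v) v) t :=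
  (hasFDerivAt_gradient hf _).comp_hasDerivAt t (hasDerivAt_line x v t)

theorem hess_symm (hf : ContDiff ℝ 2 f) (x u v : RVec d) :
    inner ℝ (hess f x u) v = inner ℝ u (hess f x v) := by
  have hd : Differentiable ℝ (fderiv ℝ f) :=
    (hf.fderiv_right (m := 1) (by norm_num)).differentiable (by norm_num)
  have key : ∀ u v : RVec d, inner ℝ (hess f x u) v = fderiv ℝ (fderiv ℝ f) x u v := by
    intro u v
    have h1 : HasDerivAt (fun s : ℝ => fderiv ℝ f (x + s • u) v)
        (fderiv ℝ (fderiv ℝ f) x u v) 0 := by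
      have h3 := (hd (x + (0 : ℝ) • u)).hasFDerivAt.comp_hasDerivAt 0 (hasDerivAt_line x u 0)
      simpa using h3.clm_apply (hasDerivAt_const (0 : ℝ) v)
    have h2 : HasDerivAt (fun s : ℝ => fderiv ℝ f (x + s • u) v) (inner ℝ (hess f x u) v) 0 := by
      have h3 := (hasDerivAt_gradient_line hf x u 0).inner ℝ (hasDerivAt_const (0 : ℝ) v)
      simpa [inner_gradient_left] using h3
    exact h2.unique h1
  have hs : IsSymmSndFDerivAt ℝ f x := hf.contDiffAt.isSymmSndFDerivAt (by simp)
  rw [key, hs.eq, ← key, real_inner_comm]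

theorem hasDerivAt_comp_line (hf : Differentiable ℝ f) (x v : RVec d) (t : ℝ) :
    HasDerivAt (fun s : ℝ => f (x + s • v)) (inner ℝ v (gradient f (x + t • v))) t := by
  have h1 := (hf (x + t • v)).hasFDerivAt.comp_hasDerivAt t
    (hasDerivAt_line x v t)
  rwa [← inner_gradient_left, real_inner_comm] at h1

theorem inner_gradient_sub_ge {μ : ℝ} (hsc : IsStronglyConvex μ f) (x y : RVec d) :
    μ * ‖x - y‖ ^ 2 ≤ inner ℝ (gradient f x - gradient f y) (x - y) := by
  have h1 := hsc x y
  have h2 := hsc y x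
  rw [← neg_sub x y, inner_neg_right, norm_neg] at h2
  rw [inner_sub_left]
  linarith

theorem hess_coercive {μ : ℝ} (hf : ContDiff ℝ 2 f) (hsc : IsStronglyConvex μ f) (x v : RVec d) :
    μ * ‖v‖ ^ 2 ≤ inner ℝ v (hess f x v) := by
  have h1 := (hasDerivAt_gradient_line hf x v 0).tendsto_slope_zero_right
  have h2 : Filter.Tendsto (fun t : ℝ => inner ℝ v (t⁻¹ • (gradient f (x + (0 + t) • v)
      - gradient f (x + (0 : ℝ) • v)))) (𝓝[>] 0) (𝓝 (inner ℝ v (hess f (x + (0 : ℝ) • v) v))) :=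
    Filter.Tendsto.inner tendsto_const_nhds h1
  rw [zero_smul, add_zero] at h2
  refine ge_of_tendsto h2 ?_
  filter_upwards [self_mem_nhdsWithin] with t ht
  have ht' : (0 : ℝ) < t := ht
  have h3 := inner_gradient_sub_ge hsc (x + t • v) x
  rw [add_sub_cancel_left, norm_smul, inner_smul_right, real_inner_comm, mul_pow,
    Real.norm_eq_abs, sq_abs] at h3
  rw [zero_add, inner_smul_right, inv_mul_eq_div, le_div_iff₀ ht']
  nlinarith

theorem gradient_eq_zero_of_isMinOn {xs : RVec d} (h : IsMinOn f Set.univ xs) :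
    gradient f xs = 0 := by
  have h1 : IsLocalMin f xs := h.isLocalMin Filter.univ_mem
  rw [gradient, h1.fderiv_eq_zero, map_zero]

end Hessian

/-! ### Self-concordance in mixed directions -/

section SelfConcordant

variable {d : ℕ} {f : RVec d → ℝ}

theorem iteratedDeriv_two_line (hf : ContDiff ℝ 2 f) (x v : RVec d) :
    iteratedDeriv 2 (fun s : ℝ => f (x + s • v)) =
      fun t => inner ℝ v (hess f (x + t • v) v) := by
  have h1 : deriv (fun s : ℝ => f (x + s • v)) = fun t => inner ℝ v (gradient f (x + t • v)) :=
    funext fun t => (hasDerivAt_comp_line (hf.differentiable (by norm_num)) x v t).deriv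
  rw [iteratedDeriv_succ, iteratedDeriv_one, h1]
  ext t
  have h2 := (hasDerivAt_const t v).inner ℝ (hasDerivAt_gradient_line hf x v t)
  simpa using h2.deriv

theorem hasDerivAt_hess_line (hd : Differentiable ℝ (hess f)) (x u v : RVec d) (t : ℝ) :
    HasDerivAt (fun s : ℝ => inner ℝ v (hess f (x + s • u) v))
      (inner ℝ v (fderiv ℝ (hess f) (x + t • u) u v)) t := by
  have h1 := (hd (x + t • u)).hasFDerivAt.comp_hasDerivAt t (hasDerivAt_line x u t)
  have h2 := h1.clm_apply (hasDerivAt_const t v)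
  have h3 := (hasDerivAt_const t v).inner ℝ h2
  simpa using h3

theorem abs_third_le (hf : IsSelfConcordant f) (x v : RVec d) :
    |inner ℝ v (fderiv ℝ (hess f) x v v)| ≤ 2 * (inner ℝ v (hess f x v)) ^ (3 / 2 : ℝ) := by
  obtain ⟨hc, hd, h⟩ := hf
  have h1 := h x v 0
  have h2 : iteratedDeriv 3 (fun s : ℝ => f (x + s • v)) 0 =
      inner ℝ v (fderiv ℝ (hess f) x v v) := by
    rw [iteratedDeriv_succ, iteratedDeriv_two_line hc]
    simpa using (hasDerivAt_hess_line hd x v v 0).deriv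
  rw [h2, iteratedDeriv_two_line hc] at h1
  simpa using h1

/-- With `fderiv_hess_symm` this makes the third derivative fully symmetric. It is the symmetry of
the second derivative of the gradient, for which differentiability of the Hessian suffices. -/
theorem fderiv_hess_swap (hf : ContDiff ℝ 2 f) (hd : Differentiable ℝ (hess f))
    (x u v : RVec d) : fderiv ℝ (hess f) x u v = fderiv ℝ (hess f) x v u :=
  second_derivative_symmetric (fun y => hasFDerivAt_gradient hf y) (hd x).hasFDerivAt u v

theorem fderiv_hess_symm (hf : ContDiff ℝ 2 f) (hd : Differentiable ℝ (hess f))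
    (x u v w : RVec d) :
    inner ℝ v (fderiv ℝ (hess f) x u w) = inner ℝ w (fderiv ℝ (hess f) x u v) := by
  have key : ∀ v w : RVec d, HasDerivAt (fun s : ℝ => inner ℝ v (hess f (x + s • u) w))
      (inner ℝ v (fderiv ℝ (hess f) x u w)) 0 := by
    intro v w
    have h1 := (hd (x + (0 : ℝ) • u)).hasFDerivAt.comp_hasDerivAt 0 (hasDerivAt_line x u 0)
    have h2 := h1.clm_apply (hasDerivAt_const (0 : ℝ) w)
    simpa using (hasDerivAt_const (0 : ℝ) v).inner ℝ h2
  have h3 : (fun s : ℝ => inner ℝ v (hess f (x + s • u) w)) =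
      fun s : ℝ => inner ℝ w (hess f (x + s • u) v) := by
    ext y
    rw [← hess_symm hf, real_inner_comm]
  exact (h3 ▸ key v w).unique (key w v)

/-- Self-concordance bounds the third derivative in mixed directions. -/
theorem abs_third_mixed_le {μ : ℝ} (hμ : 0 < μ) (hsc : IsStronglyConvex μ f)
    (hf : IsSelfConcordant f) (x u v : RVec d) :
    |inner ℝ v (fderiv ℝ (hess f) x u v)| ≤
      2 * normWrt (hess f x) u * inner ℝ v (hess f x v) := by
  have hc := hf.1
  have hd := hf.2.1
  have hco := hess_coercive hc hsc x
  have hs := hess_symm hc x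
  have hA0 : ∀ v, 0 ≤ inner ℝ v (hess f x v) := fun v =>
    (mul_nonneg hμ.le (sq_nonneg _)).trans (hco v)
  rcases eq_or_ne v 0 with rfl | hv
  · simp
  have hNv : 0 < normWrt (hess f x) v :=
    lt_of_lt_of_le (mul_pos (Real.sqrt_pos.2 hμ) (norm_pos_iff.2 hv)) (mul_norm_le_normWrt hco v)
  set N := normWrt (hess f x) with hN
  set A := hess f x with hA
  set τ := fderiv ℝ (hess f) x with hτ
  have hsw : ∀ a b, τ a b = τ b a := fderiv_hess_swap hc hd x
  have hsy : ∀ a b c, inner ℝ b (τ a c) = inner ℝ c (τ a b) := fun a b c =>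
    fderiv_hess_symm hc hd x a b c
  obtain ⟨e, he, hve⟩ : ∃ e, inner ℝ e (A e) = 1 ∧ v = N v • e := by
    refine ⟨(N v)⁻¹ • v, ?_, ?_⟩
    · rw [map_smul, inner_smul_left, inner_smul_right, ← normWrt_sq hA0]
      simp only [conj_trivial]
      rw [← hN]
      field_simp
    · rw [smul_smul, mul_inv_cancel₀ hNv.ne', one_smul]
  set p := inner ℝ u (A e) with hp
  set w := u - p • e with hw
  have hwe : inner ℝ w (A e) = 0 := by
    rw [hw, inner_sub_left, inner_smul_left, he]; simp [hp]
  have hew : inner ℝ e (A w) = 0 := by rw [← hs, real_inner_comm, hwe]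
  -- `e` and `e'` form an `A`-orthonormal basis of the plane of `u` and `v`. If `u` is parallel to
  -- `v`, then `e' = 0` serves, which is why only `≤ 1` is asked.
  obtain ⟨e', he', hee', hwe', hw'⟩ : ∃ e', inner ℝ e' (A e') ≤ 1 ∧ inner ℝ e (A e') = 0 ∧
      inner ℝ e' (A e) = 0 ∧ w = N w • e' := by
    rcases eq_or_ne w 0 with h0 | h0
    · exact ⟨0, by simp, by simp, by simp, by simp [h0]⟩
    · have hNw : 0 < N w :=
        lt_of_lt_of_le (mul_pos (Real.sqrt_pos.2 hμ) (norm_pos_iff.2 h0))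
          (mul_norm_le_normWrt hco w)
      refine ⟨(N w)⁻¹ • w, ?_, ?_, ?_, ?_⟩
      · rw [map_smul, inner_smul_left, inner_smul_right, ← normWrt_sq hA0]
        simp only [conj_trivial]
        rw [← hN]
        apply le_of_eq
        field_simp
      · rw [map_smul, inner_smul_right, hew, mul_zero]
      · rw [inner_smul_left, hwe, mul_zero]
      · rw [smul_smul, mul_inv_cancel₀ hNw.ne', one_smul]
  have hcub := abs_cubic_polar_le (t0 := inner ℝ e (τ e e)) (t1 := inner ℝ e (τ e' e))
    (t2 := inner ℝ e' (τ e' e)) (t3 := inner ℝ e' (τ e' e')) (M := 2) (by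
      intro a b hab
      have h1 := abs_third_le hf x (a • e + b • e')
      have hq : inner ℝ (a • e + b • e') (A (a • e + b • e')) ≤ 1 := by
        simp only [map_add, map_smul, inner_add_left, inner_add_right, inner_smul_left,
          inner_smul_right, conj_trivial, he, hee', hwe']
        nlinarith [sq_nonneg b]
      have h2 : inner ℝ (a • e + b • e') (A (a • e + b • e')) ^ (3 / 2 : ℝ) ≤ 1 :=
        Real.rpow_le_one (hA0 _) hq (by norm_num)
      have h3 : inner ℝ (a • e + b • e') (τ (a • e + b • e') (a • e + b • e')) =
          a ^ 3 * inner ℝ e (τ e e) + 3 * a ^ 2 * b * inner ℝ e (τ e' e)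
          + 3 * a * b ^ 2 * inner ℝ e' (τ e' e) + b ^ 3 * inner ℝ e' (τ e' e') := by
        have i1 : inner ℝ e' (τ e e) = inner ℝ e (τ e' e) := by rw [hsy, hsw]
        have i2 : inner ℝ e (τ e e') = inner ℝ e (τ e' e) := by rw [hsw]
        have i3 : inner ℝ e (τ e' e') = inner ℝ e' (τ e' e) := by rw [hsy]
        have i4 : inner ℝ e' (τ e e') = inner ℝ e' (τ e' e) := by rw [hsw]
        simp only [map_add, map_smul, inner_add_left, inner_add_right, inner_smul_left,
          inner_smul_right, conj_trivial, _root_.add_apply, _root_.smul_apply, i1, i2, i3, i4]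
        ring
      rw [← h3]
      linarith) p (N w)
  have hu : u = p • e + N w • e' := by rw [← hw', hw]; abel
  have hNu : √(p ^ 2 + N w ^ 2) = N u := by
    rw [hN]
    unfold normWrt
    congr 1
    rw [Real.sq_sqrt (hA0 _)]
    have : u = p • e + w := by rw [hw]; abel
    conv_rhs => rw [this]
    simp only [map_add, map_smul, inner_add_left, inner_add_right, inner_smul_left,
          inner_smul_right, conj_trivial, he, hew, hwe]
    ring
  have hfin : inner ℝ v (τ u v) = N v ^ 2 * (p * inner ℝ e (τ e e) + N w * inner ℝ e (τ e' e)) := by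
    conv_lhs => rw [hve, hu]
    simp only [map_add, map_smul, inner_add_right, inner_smul_left,
          inner_smul_right, conj_trivial, _root_.add_apply, _root_.smul_apply]
    ring
  rw [hfin, abs_mul, abs_of_nonneg (sq_nonneg _), ← normWrt_sq hA0, ← hNu, mul_comm]
  exact mul_le_mul_of_nonneg_right hcub (sq_nonneg _)

end SelfConcordant

/-! ### Linear models of the gradient near the minimizer -/

section LocalModel

variable {d : ℕ} {f : RVec d → ℝ} {μ : ℝ}

/-- Along a segment of local length `r < 1`, the Hessian of a self-concordant function changes by
at most the factor `(1 - r) ^ 2`. -/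
theorem hess_compare_of_isSelfConcordant (hμ : 0 < μ) (hsc : IsStronglyConvex μ f)
    (hf : IsSelfConcordant f) (x u : RVec d) (hr : normWrt (hess f x) u < 1) (v : RVec d) :
    (1 - normWrt (hess f x) u) ^ 2 * inner ℝ v (hess f x v) ≤ inner ℝ v (hess f (x + u) v) ∧
    (1 - normWrt (hess f x) u) ^ 2 * inner ℝ v (hess f (x + u) v) ≤ inner ℝ v (hess f x v) := by
  have hc := hf.1
  have hd := hf.2.1
  have hco := hess_coercive hc hsc
  have hA0 : ∀ y v, 0 ≤ inner ℝ v (hess f y v) := fun y v =>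
    (mul_nonneg hμ.le (sq_nonneg _)).trans (hco y v)
  rcases eq_or_ne u 0 with rfl | hu
  · simp [normWrt_zero]
  set r := normWrt (hess f x) u with hrdef
  have hpos : ∀ s : ℝ, 0 < inner ℝ u (hess f (x + s • u) u) := fun s =>
    lt_of_lt_of_le (mul_pos hμ (pow_pos (norm_pos_iff.2 hu) 2)) (hco _ u)
  have hr0 : 0 < r := by
    have := hpos 0
    rw [zero_smul, add_zero] at this
    exact Real.sqrt_pos.2 this
  have hmix := abs_third_mixed_le hμ hsc hf
  -- The local length `N` of `u` along the segment satisfies `N' ≤ N²`, so `1/N + s` is monotone;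
  -- this is `N ≤ r / (1 - r s)` without the division.
  have hN : ∀ s : ℝ, 0 ≤ s → normWrt (hess f (x + s • u)) u * (1 - r * s) ≤ r := by
    have hder : ∀ s : ℝ, HasDerivAt (fun s : ℝ => (normWrt (hess f (x + s • u)) u)⁻¹ + s)
        (-(inner ℝ u (fderiv ℝ (hess f) (x + s • u) u u) /
          (2 * normWrt (hess f (x + s • u)) u)) / normWrt (hess f (x + s • u)) u ^ 2 + 1) s := by
      intro s
      have h1 := ((hasDerivAt_hess_line hd x u u s).sqrt (hpos s).ne').inv
        (Real.sqrt_pos.2 (hpos s)).ne'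
      exact h1.add (hasDerivAt_id s)
    have hmono : Monotone (fun s : ℝ => (normWrt (hess f (x + s • u)) u)⁻¹ + s) := by
      refine monotone_of_deriv_nonneg (fun s => (hder s).differentiableAt) fun s => ?_
      rw [(hder s).deriv]
      have hNs : 0 < normWrt (hess f (x + s • u)) u := Real.sqrt_pos.2 (hpos s)
      have h1 := (abs_le.1 (hmix (x + s • u) u u)).2
      rw [← normWrt_sq (hA0 _)] at h1
      have h2 : inner ℝ u (fderiv ℝ (hess f) (x + s • u) u u) /
          (2 * normWrt (hess f (x + s • u)) u) / normWrt (hess f (x + s • u)) u ^ 2 ≤ 1 := by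
        rw [div_div, div_le_one (by positivity)]
        linarith
      rw [neg_div]
      linarith
    intro s hs
    have h1 := hmono hs
    simp only [zero_smul, add_zero] at h1
    rw [← hrdef] at h1
    have hNs : 0 < normWrt (hess f (x + s • u)) u := Real.sqrt_pos.2 (hpos s)
    have h2 := mul_le_mul_of_nonneg_right h1 (mul_pos hr0 hNs).le
    have h3 : r⁻¹ * (r * normWrt (hess f (x + s • u)) u) = normWrt (hess f (x + s • u)) u := by
      field_simp
    have h4 : ((normWrt (hess f (x + s • u)) u)⁻¹ + s) * (r * normWrt (hess f (x + s • u)) u) =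
        r + s * (r * normWrt (hess f (x + s • u)) u) := by
      field_simp
    rw [h3, h4] at h2
    linarith
  set h : ℝ → ℝ := fun s => inner ℝ v (hess f (x + s • u) v) with hh
  set h' : ℝ → ℝ := fun s => inner ℝ v (fderiv ℝ (hess f) (x + s • u) u v) with hh'
  have hder : ∀ s, HasDerivAt h (h' s) s := hasDerivAt_hess_line hd x u v
  have hbd : ∀ s ∈ Set.Icc (0 : ℝ) 1, |h' s| * (1 - r * s) ≤ 2 * r * h s := by
    intro s hs
    have h1 := hmix (x + s • u) u v
    have h2 : 0 ≤ 1 - r * s := by nlinarith [hs.1, hs.2]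
    have h3 := mul_le_mul_of_nonneg_right h1 h2
    have h4 := mul_le_mul_of_nonneg_left (hN s hs.1) (hA0 (x + s • u) v)
    simp only [hh, hh']
    linarith
  have hlin : ∀ s : ℝ, HasDerivAt (fun s : ℝ => 1 - r * s) (-r) s := by
    intro s
    simpa using ((hasDerivAt_id s).const_mul r).const_sub 1
  have hder1 : ∀ s, HasDerivAt (fun s => h s * (1 - r * s) ^ 2)
      (h' s * (1 - r * s) ^ 2 + h s * (2 * (1 - r * s) * (-r))) s := by
    intro s
    exact ((hder s).mul ((hlin s).pow 2)).congr_deriv (by simp)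
  have hpos1 : ∀ s ∈ Set.Icc (0 : ℝ) 1, 0 < 1 - r * s := by
    intro s hs
    nlinarith [hs.1, hs.2]
  have hder2 : ∀ s ∈ Set.Icc (0 : ℝ) 1, HasDerivAt (fun s => h s / (1 - r * s) ^ 2)
      ((h' s * (1 - r * s) ^ 2 - h s * (2 * (1 - r * s) * (-r))) / ((1 - r * s) ^ 2) ^ 2) s := by
    intro s hs
    exact ((hder s).div ((hlin s).pow 2) (pow_pos (hpos1 s hs) 2).ne').congr_deriv (by simp)
  -- The inequality `|h'| (1 - r s) ≤ 2 r h` is exactly what makes `h (1 - r s)²` decrease and `h /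
  -- (1 - r s)²` increase; the endpoints give both comparisons.
  have hanti : AntitoneOn (fun s => h s * (1 - r * s) ^ 2) (Set.Icc 0 1) := by
    refine antitoneOn_of_deriv_nonpos (convex_Icc 0 1)
      (fun s _ => (hder1 s).continuousAt.continuousWithinAt)
      (fun s _ => (hder1 s).differentiableAt.differentiableWithinAt) fun s hs => ?_
    have hs' := interior_subset hs
    rw [(hder1 s).deriv]
    have h1 := hbd s hs'
    have h2 := hpos1 s hs'
    have h3 : h' s * (1 - r * s) ≤ 2 * r * h s :=
      (mul_le_mul_of_nonneg_right (le_abs_self _) h2.le).trans h1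
    nlinarith
  have hmono : MonotoneOn (fun s => h s / (1 - r * s) ^ 2) (Set.Icc 0 1) := by
    refine monotoneOn_of_deriv_nonneg (convex_Icc 0 1)
      (fun s hs => (hder2 s hs).continuousAt.continuousWithinAt)
      (fun s hs => (hder2 s (interior_subset hs)).differentiableAt.differentiableWithinAt)
      fun s hs => ?_
    have hs' := interior_subset hs
    rw [(hder2 s hs').deriv]
    have h1 := hbd s hs'
    have h2 := hpos1 s hs'
    have h3 : -h' s * (1 - r * s) ≤ 2 * r * h s :=
      (mul_le_mul_of_nonneg_right (neg_le_abs _) h2.le).trans h1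
    apply div_nonneg _ (by positivity)
    nlinarith
  have e1 := hanti (Set.left_mem_Icc.2 zero_le_one) (Set.right_mem_Icc.2 zero_le_one) zero_le_one
  have e2 := hmono (Set.left_mem_Icc.2 zero_le_one) (Set.right_mem_Icc.2 zero_le_one) zero_le_one
  simp only [hh, zero_smul, one_smul, add_zero, mul_zero, mul_one, sub_zero, one_pow, div_one]
    at e1 e2
  constructor
  · rwa [le_div_iff₀ (by nlinarith [sub_pos.2 hr]), mul_comm] at e2
  · linarith

/-- If all Hessians on the segment from the stationary point `xs` to `x` are within the factor
`1 ± α` of `A`, then the gradient at `x` is close to its linear model with Hessian `A`. -/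
theorem abs_inner_gradient_sub_le_of_hess (hf : ContDiff ℝ 2 f) {xs : RVec d}
    (hxs : gradient f xs = 0) {A : RVec d →L[ℝ] RVec d} {α : ℝ} (hα : 0 ≤ α)
    (hs : ∀ u v, inner ℝ (A u) v = inner ℝ u (A v)) (hA : ∀ v, 0 ≤ inner ℝ v (A v))
    (w : RVec d) (h : ∀ s ∈ Set.Icc (0 : ℝ) 1, ∀ v,
      |inner ℝ v ((hess f (xs + s • w) - A) v)| ≤ α * inner ℝ v (A v)) (v : RVec d) :
    |inner ℝ v (gradient f (xs + w) - A w)| ≤ α * normWrt A v * normWrt A w := by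
  have hder : ∀ s : ℝ, HasDerivAt
      (fun s : ℝ => inner ℝ v (gradient f (xs + s • w) - s • A w))
      (inner ℝ v ((hess f (xs + s • w) - A) w)) s := by
    intro s
    have h1 := (hasDerivAt_gradient_line hf xs w s).sub ((hasDerivAt_id s).smul_const (A w))
    simpa using (hasDerivAt_const s v).inner ℝ h1
  have h1 := norm_image_sub_le_of_norm_deriv_le_segment_01'
    (fun s _ => (hder s).hasDerivWithinAt)
    (C := α * normWrt A v * normWrt A w) (fun s hs' => by
      rw [Real.norm_eq_abs]
      refine abs_inner_le_of_quadratic hα ?_ hA (h s (Set.Ico_subset_Icc_self hs')) v w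
      intro a b
      simp only [_root_.sub_apply, inner_sub_left, inner_sub_right, hs, hess_symm hf])
  simpa [hxs] using h1

/-- All points involved have local distance at most `ε/4` from `xs`, so their Hessians agree with
the one at `xs` up to `(1 - ε/4)²` and with each other up to `(1 - ε/4)⁴ ≥ 1 - ε`. For `ε ≤ 1/4`,
`1/(1 - ε) ≤ 1 + 3ε/2`. -/
theorem local_model_of_isSelfConcordant (hμ : 0 < μ) (hsc : IsStronglyConvex μ f)
    (hf : IsSelfConcordant f) {xs : RVec d} (hxs : gradient f xs = 0) {ε : ℝ} (hε : 0 < ε)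
    (hε4 : ε ≤ 1 / 4) {xt : RVec d} (hxt : xt ∈ nbhdSelfConcordant f xs ε) :
    (∀ v, (1 - ε) * inner ℝ v (hess f xs v) ≤ inner ℝ v (hess f xt v) ∧
      inner ℝ v (hess f xt v) ≤ (1 + ε) * inner ℝ v (hess f xs v)) ∧
    ∀ x ∈ nbhdSelfConcordant f xs ε, ∀ v,
      |inner ℝ v (gradient f x - hess f xt (x - xs))| ≤
        3 / 2 * ε * normWrt (hess f xt) v * normWrt (hess f xt) (x - xs) := by
  have hc := hf.1
  have hco := hess_coercive hc hsc
  have hA0 : ∀ y v, 0 ≤ inner ℝ v (hess f y v) := fun y v =>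
    (mul_nonneg hμ.le (sq_nonneg _)).trans (hco y v)
  have hcmp : ∀ u, normWrt (hess f xs) u ≤ ε / 4 → ∀ v,
      (1 - ε / 4) ^ 2 * inner ℝ v (hess f xs v) ≤ inner ℝ v (hess f (xs + u) v) ∧
      (1 - ε / 4) ^ 2 * inner ℝ v (hess f (xs + u) v) ≤ inner ℝ v (hess f xs v) := by
    intro u hu v
    obtain ⟨h1, h2⟩ := hess_compare_of_isSelfConcordant hμ hsc hf xs u (by linarith) v
    have h3 : (1 - ε / 4) ^ 2 ≤ (1 - normWrt (hess f xs) u) ^ 2 :=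
      pow_le_pow_left₀ (by linarith) (by linarith) 2
    exact ⟨(mul_le_mul_of_nonneg_right h3 (hA0 _ _)).trans h1,
      (mul_le_mul_of_nonneg_right h3 (hA0 _ _)).trans h2⟩
  have hxt' := hcmp (xt - xs) (le_of_lt hxt)
  rw [add_sub_cancel] at hxt'
  refine ⟨fun v => ?_, fun x hx v => ?_⟩
  · obtain ⟨h1, h2⟩ := hxt' v
    have h3 := hA0 xs v
    have h4 := hA0 xt v
    constructor
    · nlinarith [mul_nonneg (sq_nonneg ε) h3, mul_nonneg hε.le h3]
    · have h5 : 1 ≤ (1 + ε) * (1 - ε / 4) ^ 2 := by nlinarith [mul_pos hε hε]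
      have h6 := mul_le_mul_of_nonneg_left h2 (by linarith : 0 ≤ 1 + ε)
      have h7 := mul_le_mul_of_nonneg_right h5 h4
      nlinarith
  · have hx' : normWrt (hess f xs) (x - xs) < ε / 4 := hx
    have := abs_inner_gradient_sub_le_of_hess hc hxs (α := 3 / 2 * ε) (by positivity)
      (hess_symm hc xt) (hA0 xt) (x - xs) (fun s hs v => by
        have hsu : normWrt (hess f xs) (s • (x - xs)) ≤ ε / 4 := by
          rw [normWrt_smul _ hs.1]
          nlinarith [hs.1, hs.2, normWrt_nonneg (hess f xs) (x - xs)]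
        obtain ⟨h1, h2⟩ := hcmp _ hsu v
        obtain ⟨h3, h4⟩ := hxt' v
        set y := xs + s • (x - xs)
        have hy := hA0 y v
        have ht := hA0 xt v
        have hq : 0 ≤ (1 - ε / 4) ^ 2 := sq_nonneg _
        have h5 : (1 - ε / 4) ^ 2 * ((1 - ε / 4) ^ 2 * inner ℝ v (hess f xt v)) ≤
            inner ℝ v (hess f y v) := (mul_le_mul_of_nonneg_left h4 hq).trans h1
        have h6 : (1 - ε / 4) ^ 2 * ((1 - ε / 4) ^ 2 * inner ℝ v (hess f y v)) ≤
            inner ℝ v (hess f xt v) := (mul_le_mul_of_nonneg_left h2 hq).trans h3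
        have h7 : 1 - ε / 2 ≤ (1 - ε / 4) ^ 2 := by nlinarith [sq_nonneg ε]
        have h8 : 1 - ε ≤ (1 - ε / 4) ^ 2 * (1 - ε / 4) ^ 2 := by nlinarith
        have h9 := mul_le_mul_of_nonneg_right h8 ht
        have h10 := mul_le_mul_of_nonneg_right h8 hy
        have h11 : 1 ≤ (1 + 3 / 2 * ε) * (1 - ε) := by nlinarith
        have h12 := mul_le_mul_of_nonneg_right h11 hy
        have h13 : (1 + 3 / 2 * ε) * ((1 - ε) * inner ℝ v (hess f y v)) ≤
          (1 + 3 / 2 * ε) * inner ℝ v (hess f xt v) :=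
          mul_le_mul_of_nonneg_left (by linarith) (by linarith)
        rw [_root_.sub_apply, inner_sub_right, abs_le]
        constructor
        · nlinarith
        · nlinarith) v
    rwa [add_sub_cancel] at this

/-- Strong convexity turns membership into `L ‖x - xs‖ ≤ ε μ`. At parameter `s` of the segment the
Hessian then differs from that at `xt` by at most `(s + 1) ε μ`, and `3/2` is the integral of `s +
1`. Finally `μ ‖v‖ ‖w‖` is at most the product of the `A`-norms. -/
theorem local_model_of_hasLipschitzHessian (hμ : 0 < μ) (hsc : IsStronglyConvex μ f)
    (hc : ContDiff ℝ 2 f) {L : ℝ} (hL : 0 ≤ L) (hf : HasLipschitzHessian L f) {xs : RVec d}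
    (hxs : gradient f xs = 0) {ε : ℝ} {xt : RVec d} (hxt : xt ∈ nbhdLipschitz μ L f xs ε) :
    (∀ v, (1 - ε) * inner ℝ v (hess f xs v) ≤ inner ℝ v (hess f xt v) ∧
      inner ℝ v (hess f xt v) ≤ (1 + ε) * inner ℝ v (hess f xs v)) ∧
    ∀ x ∈ nbhdLipschitz μ L f xs ε, ∀ v,
      |inner ℝ v (gradient f x - hess f xt (x - xs))| ≤
        3 / 2 * ε * normWrt (hess f xt) v * normWrt (hess f xt) (x - xs) := by
  have hco := hess_coercive hc hsc
  have hdist : ∀ x ∈ nbhdLipschitz μ L f xs ε, L * ‖x - xs‖ ≤ ε * μ := by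
    intro x hx
    have hx' : L * normWrt (hess f xs) (x - xs) < ε * μ ^ (3 / 2 : ℝ) := hx
    have h1 := mul_le_mul_of_nonneg_left (mul_norm_le_normWrt (hco xs) (x - xs)) hL
    have h2 : μ ^ (3 / 2 : ℝ) = μ * √μ := by
      rw [Real.sqrt_eq_rpow, ← Real.rpow_one_add' hμ.le (by norm_num)]
      norm_num
    rw [h2] at hx'
    have h3 : √μ * (L * ‖x - xs‖) ≤ √μ * (ε * μ) := by linarith
    exact le_of_mul_le_mul_left h3 (Real.sqrt_pos.2 hμ)
  refine ⟨fun v => ?_, fun x hx v => ?_⟩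
  · have h1 : |inner ℝ v ((hess f xt - hess f xs) v)| ≤ ε * (μ * ‖v‖ ^ 2) := by
      calc _ ≤ ‖v‖ * (‖hess f xt - hess f xs‖ * ‖v‖) :=
            (abs_real_inner_le_norm _ _).trans
              (mul_le_mul_of_nonneg_left (ContinuousLinearMap.le_opNorm _ _) (norm_nonneg _))
        _ ≤ ‖v‖ * ((ε * μ) * ‖v‖) := by
            gcongr
            exact (hf _ _).trans (hdist xt hxt)
        _ = _ := by ring
    have hε : 0 ≤ ε := nonneg_of_mul_nonneg_left
      ((mul_nonneg hL (norm_nonneg _)).trans (hdist xt hxt)) hμ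
    have h2 := mul_le_mul_of_nonneg_left (hco xs v) hε
    rw [_root_.sub_apply, inner_sub_right, abs_le] at h1
    constructor <;> linarith
  · set w := x - xs with hw
    have hε : 0 ≤ ε := nonneg_of_mul_nonneg_left
      ((mul_nonneg hL (norm_nonneg _)).trans (hdist xt hxt)) hμ
    have hder : ∀ s : ℝ, HasDerivAt
        (fun s : ℝ => gradient f (xs + s • w) - s • hess f xt w)
        ((hess f (xs + s • w) - hess f xt) w) s := by
      intro s
      exact ((hasDerivAt_gradient_line hc xs w s).sub
        ((hasDerivAt_id s).smul_const (hess f xt w))).congr_deriv (by simp)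
    have hB : ∀ s : ℝ, HasDerivAt (fun s : ℝ => (s ^ 2 / 2 + s) * (ε * μ * ‖w‖))
        ((s + 1) * (ε * μ * ‖w‖)) s := by
      intro s
      have h1 := ((((hasDerivAt_id s).pow 2).div_const 2).add (hasDerivAt_id s)).mul_const
        (ε * μ * ‖w‖)
      simpa using h1
    have hbound := image_norm_le_of_norm_deriv_right_le_deriv_boundary
      (f := fun s : ℝ => gradient f (xs + s • w) - s • hess f xt w) (a := 0) (b := 1)
      (fun s _ => (hder s).continuousAt.continuousWithinAt)
      (fun s _ => (hder s).hasDerivWithinAt) (by simp [hxs]) hB (fun s hs => by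
        have h1 : ‖hess f (xs + s • w) - hess f xt‖ ≤ (s + 1) * (ε * μ) := by
          have h2 : ‖xs + s • w - xt‖ ≤ s * ‖w‖ + ‖xt - xs‖ := by
            have : xs + s • w - xt = s • w - (xt - xs) := by abel
            rw [this]
            refine (norm_sub_le _ _).trans_eq ?_
            rw [norm_smul, Real.norm_eq_abs, abs_of_nonneg hs.1]
          have h3 := hdist x hx
          have h4 := hdist xt hxt
          have h5 := mul_le_mul_of_nonneg_left h2 hL
          have h6 := mul_le_mul_of_nonneg_left h3 hs.1
          have h7 := hf (xs + s • w) xt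
          linarith
        calc _ ≤ ‖hess f (xs + s • w) - hess f xt‖ * ‖w‖ := ContinuousLinearMap.le_opNorm _ _
          _ ≤ (s + 1) * (ε * μ) * ‖w‖ := by gcongr
          _ = _ := by ring) (Set.right_mem_Icc.2 zero_le_one)
    simp only [one_smul] at hbound
    rw [hw, add_sub_cancel, ← hw] at hbound
    have hv := mul_norm_le_normWrt (hco xt) v
    have hw' := mul_norm_le_normWrt (hco xt) w
    have hμs : √μ * √μ = μ := Real.mul_self_sqrt hμ.le
    calc _ ≤ ‖v‖ * ‖gradient f x - hess f xt w‖ := abs_real_inner_le_norm _ _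
      _ ≤ ‖v‖ * ((1 ^ 2 / 2 + 1) * (ε * μ * ‖w‖)) := by gcongr
      _ = 3 / 2 * ε * (√μ * ‖v‖) * (√μ * ‖w‖) := by
        linear_combination (-3 / 2 * ε * ‖v‖ * ‖w‖) * hμs
      _ ≤ _ := by
        have := normWrt_nonneg (hess f xt) v
        gcongr

end LocalModel

/-! ### A dimension-free Bernstein inequality -/

section Concentration

/-- A one-step estimate for the hyperbolic cosine of the norm in an inner product space. -/
theorem cosh_norm_add_le {E : Type*} [NormedAddCommGroup E] [InnerProductSpace ℝ E] (s x : E) :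
    Real.cosh ‖s + x‖ ≤ Real.cosh ‖s‖ * (Real.exp ‖x‖ - ‖x‖)
      + inner ℝ ((Real.sinh ‖s‖ / ‖s‖) • s) x := by
  set a := ‖s‖ with ha
  set r := ‖x‖ with hr
  set u := inner ℝ s x / (a * r) with hu
  have ha0 : 0 ≤ a := norm_nonneg _
  have hr0 : 0 ≤ r := norm_nonneg _
  have hu1 : |u| ≤ 1 := abs_real_inner_div_norm_mul_norm_le_one s x
  obtain ⟨hul, hur⟩ := abs_le.1 hu1
  have hsx : inner ℝ s x = a * r * u := by
    rcases eq_or_ne s 0 with rfl | h1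
    · simp [ha]
    rcases eq_or_ne x 0 with rfl | h2
    · simp [hr]
    rw [hu, mul_div_cancel₀]
    exact mul_ne_zero (norm_ne_zero_iff.2 h1) (norm_ne_zero_iff.2 h2)
  have hsq : ‖s + x‖ ^ 2 = (1 + u) / 2 * (a + r) ^ 2 + (1 - u) / 2 * (a - r) ^ 2 := by
    rw [norm_add_sq_real, hsx]
    ring
  -- `cosh` is a power series in the square of its argument with nonnegative coefficients, hence
  -- convex in that square; apply this termwise to `hsq`.
  have h1 : Real.cosh ‖s + x‖ ≤ (1 + u) / 2 * Real.cosh (a + r) + (1 - u) / 2 * Real.cosh (a - r) := by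
    refine hasSum_le (fun n => ?_) (Real.hasSum_cosh ‖s + x‖)
      (((Real.hasSum_cosh (a + r)).mul_left _).add ((Real.hasSum_cosh (a - r)).mul_left _))
    have hc := (convexOn_pow (𝕜 := ℝ) n).2
    have h2 := hc (Set.mem_Ici.2 (sq_nonneg (a + r))) (Set.mem_Ici.2 (sq_nonneg (a - r)))
      (by linarith : (0 : ℝ) ≤ (1 + u) / 2) (by linarith : (0 : ℝ) ≤ (1 - u) / 2) (by ring)
    simp only [smul_eq_mul] at h2
    rw [← hsq, ← pow_mul, ← pow_mul, ← pow_mul] at h2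
    rw [← mul_div_assoc, ← mul_div_assoc, ← add_div]
    exact div_le_div_of_nonneg_right h2 (by positivity)
  have h2 : inner ℝ ((Real.sinh a / a) • s) x = Real.sinh a * (r * u) := by
    rw [inner_smul_left, hsx]
    rcases eq_or_ne a 0 with h0 | h0
    · simp [h0]
    · simp only [conj_trivial]
      field_simp
  rw [h2, ← Real.cosh_add_sinh r]
  rw [Real.cosh_add, Real.cosh_sub] at h1
  -- Only the excess `sinh r - r` is bounded crudely. The part of the cross term linear in `x` stays
  -- exact, since it vanishes in expectation.
  have h3 : 0 ≤ Real.sinh r - r := sub_nonneg.2 (Real.self_le_sinh_iff.2 hr0)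
  have h4 : u * Real.sinh a ≤ Real.cosh a :=
    (mul_le_of_le_one_left (Real.sinh_nonneg_iff.2 ha0) hur).trans (Real.sinh_lt_cosh a).le
  have h5 := mul_le_mul_of_nonneg_right h4 h3
  linarith

variable {d : ℕ} {Z : Type*} [MeasurableSpace Z] {D : Measure Z} [IsProbabilityMeasure D]

/-- The linear term of `cosh_norm_add_le` integrates to zero, and `exp r - r ≤ 1 + r²` for `r ≤ 1`
leaves the factor `1 + V ≤ exp V`. -/
theorem integral_cosh_norm_add_le {X : Z → RVec d} (hX : Measurable X) (hb : ∀ z, ‖X z‖ ≤ 1)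
    (h0 : ∫ z, X z ∂D = 0) {V : ℝ} (hV : ∫ z, ‖X z‖ ^ 2 ∂D ≤ V) (s : RVec d) :
    ∫ z, Real.cosh ‖s + X z‖ ∂D ≤ Real.cosh ‖s‖ * Real.exp V := by
  have hint : Integrable X D := Integrable.of_bound hX.aestronglyMeasurable 1 (ae_of_all _ hb)
  have hint2 : Integrable (fun z => ‖X z‖ ^ 2) D :=
    Integrable.of_bound (by fun_prop) 1 (ae_of_all _ fun z => by
      rw [norm_pow, norm_norm]
      exact pow_le_one₀ (norm_nonneg _) (hb z))
  have hint3 : Integrable (fun z => inner ℝ ((Real.sinh ‖s‖ / ‖s‖) • s) (X z)) D :=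
    hint.const_inner _
  have hpt : ∀ z, Real.cosh ‖s + X z‖ ≤ Real.cosh ‖s‖ * (1 + ‖X z‖ ^ 2)
      + inner ℝ ((Real.sinh ‖s‖ / ‖s‖) • s) (X z) := by
    intro z
    refine (cosh_norm_add_le s (X z)).trans ?_
    have h1 := (abs_le.1 (Real.abs_exp_sub_one_sub_id_le (x := ‖X z‖)
      (by rw [abs_of_nonneg (norm_nonneg _)]; exact hb z))).2
    have h2 := mul_le_mul_of_nonneg_left
      (by linarith : Real.exp ‖X z‖ - ‖X z‖ ≤ 1 + ‖X z‖ ^ 2) (Real.cosh_pos ‖s‖).le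
    linarith
  have hint4 : Integrable (fun z => Real.cosh ‖s‖ * (1 + ‖X z‖ ^ 2)) D :=
    ((integrable_const 1).add hint2).const_mul _
  have h1 : ∫ z, Real.cosh ‖s + X z‖ ∂D ≤ ∫ z, (Real.cosh ‖s‖ * (1 + ‖X z‖ ^ 2)
      + inner ℝ ((Real.sinh ‖s‖ / ‖s‖) • s) (X z)) ∂D :=
    integral_mono_of_nonneg (ae_of_all _ fun z => (Real.cosh_pos _).le)
      (hint4.add hint3) (ae_of_all _ hpt)
  rw [integral_add hint4 hint3, integral_inner hint, h0, inner_zero_right, add_zero,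
    integral_const_mul, integral_add (integrable_const 1) hint2] at h1
  simp only [integral_const, probReal_univ, smul_eq_mul, mul_one] at h1
  refine h1.trans (mul_le_mul_of_nonneg_left ?_ (Real.cosh_pos _).le)
  linarith [Real.add_one_le_exp V]

theorem integrable_cosh_norm_add_sum {X : Z → RVec d} (hX : Measurable X) (hb : ∀ z, ‖X z‖ ≤ 1)
    (n : ℕ) (s : RVec d) :
    Integrable (fun z : Fin n → Z => Real.cosh ‖s + ∑ i, X (z i)‖) (Measure.pi fun _ => D) := by
  refine Integrable.of_bound ?_ (Real.cosh (‖s‖ + n)) (ae_of_all _ fun z => ?_)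
  · have : Measurable fun z : Fin n → Z => Real.cosh ‖s + ∑ i, X (z i)‖ := by fun_prop
    exact this.aestronglyMeasurable
  · rw [Real.norm_eq_abs, abs_of_pos (Real.cosh_pos _), Real.cosh_le_cosh, abs_norm]
    refine le_trans ?_ (le_abs_self _)
    refine (norm_add_le _ _).trans ?_
    gcongr
    refine (norm_sum_le _ _).trans ?_
    refine (Finset.sum_le_sum fun i _ => hb (z i)).trans ?_
    simp

theorem integral_cosh_norm_add_sum_le {X : Z → RVec d} (hX : Measurable X) (hb : ∀ z, ‖X z‖ ≤ 1)
    (h0 : ∫ z, X z ∂D = 0) {V : ℝ} (hV : ∫ z, ‖X z‖ ^ 2 ∂D ≤ V) (n : ℕ) (s : RVec d) :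
    ∫ z : Fin n → Z, Real.cosh ‖s + ∑ i, X (z i)‖ ∂(Measure.pi fun _ => D) ≤
      Real.cosh ‖s‖ * Real.exp (n * V) := by
  induction n generalizing s with
  | zero => simp
  | succ n ih =>
    have hmp := (measurePreserving_piFinSuccAbove (fun _ : Fin (n + 1) => D) 0).symm
    rw [← hmp.integral_comp']
    have hint := (hmp.integrable_comp_emb (MeasurableEquiv.measurableEmbedding _)).2
      (integrable_cosh_norm_add_sum (D := D) hX hb (n + 1) s)
    refine le_of_eq_of_le (integral_prod _ hint) ?_
    have e : ∀ (z : Z) (y : Fin n → Z), s + ∑ i, X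
        ((MeasurableEquiv.piFinSuccAbove (fun _ : Fin (n + 1) => Z) 0).symm (z, y) i) =
        (s + X z) + ∑ i, X (y i) := by
      intro z y
      rw [Fin.sum_univ_succ, ← add_assoc]
      simp [MeasurableEquiv.piFinSuccAbove_symm_apply, Fin.insertNthEquiv]
    simp only [e]
    have h1 : ∫ z, ∫ y : Fin n → Z, Real.cosh ‖s + X z + ∑ i, X (y i)‖ ∂(Measure.pi fun _ => D) ∂D
        ≤ ∫ z, Real.cosh ‖s + X z‖ * Real.exp (n * V) ∂D := by
      refine integral_mono_of_nonneg
        (ae_of_all _ fun z => integral_nonneg fun y => (Real.cosh_pos _).le) ?_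
        (ae_of_all _ fun z => ih (s + X z))
      refine Integrable.mul_const ?_ _
      refine Integrable.of_bound (by fun_prop) (Real.cosh (‖s‖ + 1)) (ae_of_all _ fun z => ?_)
      rw [Real.norm_eq_abs, abs_of_pos (Real.cosh_pos _), Real.cosh_le_cosh, abs_norm]
      refine le_trans ?_ (le_abs_self _)
      exact (norm_add_le _ _).trans (by gcongr; exact hb z)
    refine h1.trans ?_
    rw [integral_mul_const]
    refine (mul_le_mul_of_nonneg_right (integral_cosh_norm_add_le hX hb h0 hV s)
      (Real.exp_pos _).le).trans_eq ?_
    rw [mul_assoc, ← Real.exp_add]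
    push_cast
    ring_nf

/-- A dimension-free Bernstein-type tail bound for sums of independent bounded centered vectors. -/
theorem measureReal_norm_sum_ge_le {X : Z → RVec d} (hX : Measurable X) {R V θ : ℝ}
    (hb : ∀ z, ‖X z‖ ≤ R) (h0 : ∫ z, X z ∂D = 0) (hV : ∫ z, ‖X z‖ ^ 2 ∂D ≤ V) (hθ : 0 ≤ θ)
    (hθR : θ * R ≤ 1) (n : ℕ) (τ : ℝ) :
    (Measure.pi fun _ : Fin n => D).real {z | τ ≤ ‖∑ i, X (z i)‖} ≤
      2 * Real.exp (n * (θ ^ 2 * V) - θ * τ) := by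
  have hb' : ∀ z, ‖θ • X z‖ ≤ 1 := fun z => by
    rw [norm_smul, Real.norm_eq_abs, abs_of_nonneg hθ]
    exact (mul_le_mul_of_nonneg_left (hb z) hθ).trans hθR
  have h0' : ∫ z, θ • X z ∂D = 0 := by rw [integral_smul, h0, smul_zero]
  have hV' : ∫ z, ‖θ • X z‖ ^ 2 ∂D ≤ θ ^ 2 * V := by
    simp only [norm_smul, mul_pow, Real.norm_eq_abs, sq_abs]
    rw [integral_const_mul]
    exact mul_le_mul_of_nonneg_left hV (sq_nonneg _)
  have hX' : Measurable fun z => θ • X z := hX.const_smul θ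
  have hmain := integral_cosh_norm_add_sum_le hX' hb' h0' hV' n 0
  have hint := integrable_cosh_norm_add_sum (D := D) hX' hb' n 0
  rw [norm_zero, Real.cosh_zero, one_mul] at hmain
  -- Markov's inequality for `cosh`; the threshold comes from `cosh y ≥ exp y / 2`, the source of
  -- the factor `2`.
  have hmk := mul_meas_ge_le_integral_of_nonneg (ae_of_all _ fun z => (Real.cosh_pos _).le) hint
    (Real.exp (θ * τ) / 2)
  have hsub : (Measure.pi fun _ : Fin n => D).real {z | τ ≤ ‖∑ i, X (z i)‖} ≤
      (Measure.pi fun _ : Fin n => D).real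
        {z | Real.exp (θ * τ) / 2 ≤ Real.cosh ‖0 + ∑ i, θ • X (z i)‖} := by
    refine measureReal_mono fun z hz => ?_
    have hz' : τ ≤ ‖∑ i, X (z i)‖ := hz
    rw [Set.mem_ofPred_eq, zero_add, ← Finset.smul_sum, norm_smul, Real.norm_eq_abs,
      abs_of_nonneg hθ, Real.cosh_eq]
    have h1 : Real.exp (θ * τ) ≤ Real.exp (θ * ‖∑ i, X (z i)‖) :=
      Real.exp_le_exp.2 (mul_le_mul_of_nonneg_left hz' hθ)
    have h2 := Real.exp_pos (-(θ * ‖∑ i, X (z i)‖))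
    linarith
  rw [Real.exp_sub]
  rw [mul_div_assoc', le_div_iff₀ (Real.exp_pos _)]
  have h3 := mul_le_mul_of_nonneg_right hsub (Real.exp_pos (θ * τ)).le
  linarith

end Concentration

/-! ### Cocoercivity of gradients -/

section Smooth

variable {d : ℕ}

theorem inner_gradient_sub_le_of_convexOn {ψ : RVec d → ℝ} (hc : ConvexOn ℝ Set.univ ψ)
    (hd : Differentiable ℝ ψ) (x y : RVec d) :
    ψ x + inner ℝ (gradient ψ x) (y - x) ≤ ψ y := by
  have h1 : HasDerivAt (fun s : ℝ => ψ (x + s • (y - x))) (inner ℝ (gradient ψ x) (y - x)) 0 := by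
    simpa [real_inner_comm] using hasDerivAt_comp_line hd x (y - x) 0
  have h2 := h1.tendsto_slope_zero_right
  have h3 : inner ℝ (gradient ψ x) (y - x) ≤ ψ y - ψ x := by
    refine le_of_tendsto h2 ?_
    filter_upwards [Ioo_mem_nhdsGT (show (0 : ℝ) < 1 by norm_num)] with t ht
    have h4 := hc.2 (Set.mem_univ x) (Set.mem_univ y) (sub_nonneg.2 ht.2.le) ht.1.le (by ring)
    have h5 : (1 - t) • x + t • y = x + (0 + t) • (y - x) := by module
    rw [h5] at h4
    simp only [smul_eq_mul] at h4
    rw [zero_smul, add_zero, smul_eq_mul, inv_mul_eq_div, div_le_iff₀ ht.1]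
    linarith
  linarith

/-- Cocoercivity of the gradient of a convex smooth function. -/
theorem norm_gradient_sub_sq_le {ψ : RVec d → ℝ} {lam : ℝ} (hlam : 0 < lam)
    (hc : ConvexOn ℝ Set.univ ψ) (hs : IsSmooth lam ψ) (x y : RVec d) :
    ‖gradient ψ x - gradient ψ y‖ ^ 2 ≤ lam * inner ℝ (gradient ψ x - gradient ψ y) (x - y) := by
  have key : ∀ x y : RVec d, ‖gradient ψ x - gradient ψ y‖ ^ 2 ≤
      2 * lam * (ψ y - ψ x - inner ℝ (gradient ψ x) (y - x)) := by
    intro x y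
    set g := gradient ψ y - gradient ψ x with hg
    -- A gradient step of length `1/lam` from `y` on `ψ` minus its tangent at `x`, a function
    -- minimized at `x`.
    have h1 := hs.2 (y - lam⁻¹ • g) y
    have h2 := inner_gradient_sub_le_of_convexOn hc hs.1 x (y - lam⁻¹ • g)
    rw [sub_sub_cancel_left, inner_neg_right, inner_smul_right, norm_neg, norm_smul, mul_pow,
      Real.norm_eq_abs, sq_abs] at h1
    rw [sub_right_comm, inner_sub_right, inner_smul_right] at h2
    have h3 : inner ℝ (gradient ψ y) g - inner ℝ (gradient ψ x) g = ‖g‖ ^ 2 := by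
      rw [← inner_sub_left, real_inner_self_eq_norm_sq]
    have h4 : lam / 2 * (lam⁻¹ ^ 2 * ‖g‖ ^ 2) = lam⁻¹ * ‖g‖ ^ 2 / 2 := by field_simp
    rw [h4] at h1
    rw [norm_sub_rev, ← hg]
    have h5 : lam⁻¹ * (inner ℝ (gradient ψ y) g - inner ℝ (gradient ψ x) g) = lam⁻¹ * ‖g‖ ^ 2 := by
      rw [h3]
    have h6 : lam⁻¹ * ‖g‖ ^ 2 ≤ 2 * (ψ y - ψ x - inner ℝ (gradient ψ x) (y - x)) := by linarith
    have h7 := mul_le_mul_of_nonneg_left h6 hlam.le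
    rw [← mul_assoc, mul_inv_cancel₀ hlam.ne', one_mul] at h7
    linarith
  have h1 := key x y
  have h2 := key y x
  rw [← neg_sub x y, inner_neg_right] at h1
  rw [norm_sub_rev] at h2
  rw [inner_sub_left]
  linarith

theorem norm_sub_le_of_cocoercive {lam : ℝ} (hlam : 0 < lam) {g h x y : RVec d}
    (hc : ‖g - h‖ ^ 2 ≤ lam * inner ℝ (g - h) (x - y)) : ‖g - h‖ ≤ lam * ‖x - y‖ := by
  have h1 := mul_le_mul_of_nonneg_left (real_inner_le_norm (g - h) (x - y)) hlam.le
  by_contra hcon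
  push Not at hcon
  have h2 : 0 < ‖g - h‖ := lt_of_le_of_lt (by positivity) hcon
  nlinarith

end Smooth

/-! ### A measurable version of the stochastic gradient -/

section Oracle

variable {d : ℕ} {Z : Type*} [MeasurableSpace Z] {D : Measure Z}

theorem aemeasurable_gradient {ψ : Z → RVec d → ℝ}
    (hint : ∀ x, Integrable (fun z => ψ z x) D) (hd : ∀ᵐ z ∂D, Differentiable ℝ (ψ z))
    (x : RVec d) : AEMeasurable (fun z => gradient (ψ z) x) D := by
  have hcomp : ∀ i : Fin d, AEMeasurable (fun z => gradient (ψ z) x i) D := by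
    intro i
    set e : RVec d := EuclideanSpace.single i 1 with he
    refine aemeasurable_of_tendsto_metrizable_ae (𝓝[>] (0 : ℝ))
      (f := fun t z => t⁻¹ * (ψ z (x + t • e) - ψ z x)) (fun t => ?_) ?_
    · exact ((hint _).aestronglyMeasurable.aemeasurable.sub
        (hint _).aestronglyMeasurable.aemeasurable).const_mul _
    · filter_upwards [hd] with z hz
      have h1 : HasDerivAt (fun s : ℝ => ψ z (x + s • e)) (gradient (ψ z) x i) 0 := by
        have h2 := hasDerivAt_comp_line hz x e 0
        have h3 : inner ℝ e (gradient (ψ z) (x + (0 : ℝ) • e)) = gradient (ψ z) x i := by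
          rw [he, EuclideanSpace.inner_single_left]; simp
        rwa [h3] at h2
      simpa using h1.tendsto_slope_zero_right
  have h1 : AEMeasurable (fun z => fun i => gradient (ψ z) x i) D := aemeasurable_pi_lambda _ hcomp
  exact (WithLp.measurable_toLp 2 _).comp_aemeasurable h1

/-- A jointly measurable family of stochastic gradients with mean `g` which is everywhere
cocoercive. -/
structure IsGradientOracle (lam : ℝ) (D : Measure Z) (G : Z → RVec d → RVec d)
    (g : RVec d → RVec d) : Prop where
  measurable : Measurable fun p : RVec d × Z => G p.2 p.1
  cocoercive : ∀ z x y, ‖G z x - G z y‖ ^ 2 ≤ lam * inner ℝ (G z x - G z y) (x - y)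
  integrable : ∀ x, Integrable (fun z => G z x) D
  integral_eq : ∀ x, ∫ z, G z x ∂D = g x

/-- `ψ` is not assumed jointly measurable and its regularity holds only almost surely. Setting the
gradient to zero on a measurable null set makes it cocoercive everywhere, hence continuous in `x`;
measurability on a dense sequence then spreads to all points and to pairs. -/
theorem exists_isGradientOracle [IsProbabilityMeasure D] {ψ : Z → RVec d → ℝ}
    {f : RVec d → ℝ} {lam : ℝ} (hlam : 0 < lam)
    (hc : ∀ᵐ z ∂D, ConvexOn ℝ Set.univ (ψ z))
    (hint : ∀ x, Integrable (fun z => ψ z x) D) (hf : ∀ x, f x = ∫ z, ψ z x ∂D)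
    (hfd : Differentiable ℝ f) (hs : ∀ᵐ z ∂D, IsSmooth lam (ψ z)) :
    ∃ G : Z → RVec d → RVec d, IsGradientOracle lam D G (gradient f) ∧
      ∀ᵐ z ∂D, ∀ x, gradient (ψ z) x = G z x := by
  have hm := aemeasurable_gradient hint (hs.mono fun z hz => hz.1)
  set q := TopologicalSpace.denseSeq (RVec d) with hq
  have hgood : ∀ᵐ z ∂D, (ConvexOn ℝ Set.univ (ψ z) ∧ IsSmooth lam (ψ z)) ∧
      ∀ n, gradient (ψ z) (q n) = (hm (q n)).mk _ z :=
    (hc.and hs).and (ae_all_iff.2 fun n => (hm (q n)).ae_eq_mk)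
  obtain ⟨N, hsub, hNm, hN0⟩ := exists_measurable_superset_of_null (ae_iff.1 hgood)
  have hN : ∀ z ∉ N, (ConvexOn ℝ Set.univ (ψ z) ∧ IsSmooth lam (ψ z)) ∧
      ∀ n, gradient (ψ z) (q n) = (hm (q n)).mk _ z := by
    intro z hz
    by_contra hcon
    exact hz (hsub hcon)
  classical
  set G : Z → RVec d → RVec d := fun z x => if z ∈ N then 0 else gradient (ψ z) x with hG
  have hco : ∀ z x y, ‖G z x - G z y‖ ^ 2 ≤ lam * inner ℝ (G z x - G z y) (x - y) := by
    intro z x y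
    by_cases hz : z ∈ N
    · simp [hG, hz]
    · simp only [hG, hz, if_false]
      exact norm_gradient_sub_sq_le hlam (hN z hz).1.1 (hN z hz).1.2 x y
  have hcont : ∀ z, Continuous (G z) := fun z =>
    (LipschitzWith.of_dist_le_mul (K := ⟨lam, hlam.le⟩) fun x y => by
      rw [dist_eq_norm, dist_eq_norm]
      exact norm_sub_le_of_cocoercive hlam (hco z x y)).continuous
  have hmq : ∀ n, Measurable fun z => G z (q n) := by
    intro n
    have : (fun z => G z (q n)) = fun z => if z ∈ N then 0 else (hm (q n)).mk _ z := by
      ext1 z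
      by_cases hz : z ∈ N
      · simp [hG, hz]
      · simp only [hG, hz, if_false]
        exact (hN z hz).2 n
    rw [this]
    exact Measurable.ite hNm measurable_const (hm (q n)).measurable_mk
  have hmx : ∀ x, Measurable fun z => G z x := by
    intro x
    obtain ⟨y, hy, hyx⟩ := mem_closure_iff_seq_limit.1
      (TopologicalSpace.denseRange_denseSeq (RVec d) x)
    refine measurable_of_tendsto_metrizable (f := fun n z => G z (y n)) (fun n => ?_)
      (tendsto_pi_nhds.2 fun z => ((hcont z).tendsto x).comp hyx)
    obtain ⟨k, hk⟩ := hy n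
    rw [← hk]
    exact hmq k
  have hae : ∀ᵐ z ∂D, ∀ x, gradient (ψ z) x = G z x := by
    have : ∀ᵐ z ∂D, z ∉ N := measure_eq_zero_iff_ae_notMem.1 hN0
    filter_upwards [this] with z hz x
    simp [hG, hz]
  have hlow : ∀ᵐ z ∂D, ∀ x y, ψ z x + inner ℝ (G z x) (y - x) ≤ ψ z y := by
    filter_upwards [hc, hs, hae] with z h1 h2 h3 x y
    rw [← h3]
    exact inner_gradient_sub_le_of_convexOn h1 h2.1 x y
  have hGint : ∀ x, Integrable (fun z => G z x) D := by
    intro x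
    have hcomp : ∀ i : Fin d, Integrable (fun z => G z x i) D := by
      intro i
      set e : RVec d := EuclideanSpace.single i 1 with he
      -- Convexity bounds a partial derivative by the increments of `ψ z` over unit steps in both
      -- directions.
      have hb : ∀ᵐ z ∂D, ‖G z x i‖ ≤ ‖|ψ z (x + e) - ψ z x| + |ψ z (x - e) - ψ z x|‖ := by
        filter_upwards [hlow] with z hz
        have h1 := hz x (x + e)
        have h2 := hz x (x - e)
        rw [add_sub_cancel_left] at h1
        rw [sub_sub_cancel_left, inner_neg_right] at h2
        have h3 : inner ℝ (G z x) e = G z x i := by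
          rw [he, EuclideanSpace.inner_single_right]; simp
        rw [h3] at h1 h2
        rw [Real.norm_eq_abs, Real.norm_eq_abs]
        refine le_trans ?_ (le_abs_self _)
        rw [abs_le]
        constructor
        · linarith [le_abs_self (ψ z (x - e) - ψ z x), abs_nonneg (ψ z (x + e) - ψ z x)]
        · linarith [le_abs_self (ψ z (x + e) - ψ z x), abs_nonneg (ψ z (x - e) - ψ z x)]
      refine Integrable.mono ((((hint (x + e)).sub (hint x)).abs).add
        (((hint (x - e)).sub (hint x)).abs)) ?_ hb
      exact ((measurable_pi_apply i).comp
        ((WithLp.measurable_ofLp 2 _).comp (hmx x))).aestronglyMeasurable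
    have hsum : (fun z => G z x) = fun z => ∑ i, G z x i • EuclideanSpace.single i (1 : ℝ) := by
      ext z j
      simp [Finset.sum_apply, Pi.single_apply]
    rw [hsum]
    exact integrable_finsetSum _ fun i _ => (hcomp i).smul_const _
  refine ⟨G, ⟨measurable_uncurry_of_continuous_of_measurable (u := fun x z => G z x) hcont hmx,
    hco, hGint, fun x => ?_⟩, hae⟩
  set a := ∫ z, G z x ∂D with ha
  -- The mean `a` is a subgradient of `f` at `x`, and differentiability of `f` forces `a = ∇f x`; no
  -- differentiation under the integral is needed.
  have hmin : ∀ y, f x + inner ℝ a (y - x) ≤ f y := by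
    intro y
    have h1 : ∫ z, (ψ z x + inner ℝ (y - x) (G z x)) ∂D ≤ ∫ z, ψ z y ∂D := by
      refine integral_mono_ae ((hint x).add ((hGint x).const_inner (y - x))) (hint y) ?_
      filter_upwards [hlow] with z hz
      rw [real_inner_comm]
      exact hz x y
    rw [integral_add (hint x) ((hGint x).const_inner (y - x)), integral_inner (hGint x),
      ← hf, ← hf, real_inner_comm] at h1
    exact h1
  have hder : HasFDerivAt (fun y => f y - inner ℝ a (y - x)) (fderiv ℝ f x - innerSL ℝ a) x := by
    refine (hfd x).hasFDerivAt.sub ?_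
    exact (innerSL ℝ a).hasFDerivAt.comp x ((hasFDerivAt_id x).sub_const x)
  have hloc : IsLocalMin (fun y => f y - inner ℝ a (y - x)) x := by
    refine Filter.Eventually.of_forall fun y => ?_
    have := hmin y
    simp only [sub_self, inner_zero_right, sub_zero]
    linarith
  have h0 := hloc.hasFDerivAt_eq_zero hder
  refine ext_inner_right ℝ fun v => ?_
  have h2 := congrArg (fun T : RVec d →L[ℝ] ℝ => T v) h0
  simp only [_root_.sub_apply, innerSL_apply_apply, _root_.zero_apply] at h2
  rw [inner_gradient_left]
  linarith

end Oracle

/-! ### Iterates driven by the measurable oracle -/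

section Iterates

/-- The inner iterates driven by an arbitrary stochastic gradient `G`. -/
noncomputable def oracleIterate {d m : ℕ} {Z : Type*} (G : Z → RVec d → RVec d)
    (B : RVec d →L[ℝ] RVec d) (g x0 : RVec d) (ζ : ℕ → Fin m → Z) : ℕ → RVec d
  | 0 => x0
  | k + 1 =>
      oracleIterate G B g x0 ζ k - B ((1 / (m : ℝ)) • ∑ i : Fin m,
        (G (ζ k i) (oracleIterate G B g x0 ζ k) - G (ζ k i) x0) + g)

variable {d m : ℕ} {Z : Type*}

theorem svrnIterate_eq_oracleIterate {ψ : Z → RVec d → ℝ} {G : Z → RVec d → RVec d}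
    {B : RVec d →L[ℝ] RVec d} {g x0 : RVec d} {ζ : ℕ → Fin m → Z}
    (h : ∀ k i x, gradient (ψ (ζ k i)) x = G (ζ k i) x) (k : ℕ) :
    svrnIterate ψ B g x0 ζ k = oracleIterate G B g x0 ζ k := by
  induction k with
  | zero => rfl
  | succ k ih => rw [svrnIterate, oracleIterate, ih]; simp only [h]

theorem oracleIterate_congr {G : Z → RVec d → RVec d} {B : RVec d →L[ℝ] RVec d} {g x0 : RVec d}
    {ζ ζ' : ℕ → Fin m → Z} {k : ℕ} (h : ∀ j < k, ∀ i, ζ j i = ζ' j i) :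
    oracleIterate G B g x0 ζ k = oracleIterate G B g x0 ζ' k := by
  induction k with
  | zero => rfl
  | succ k ih =>
    rw [oracleIterate, oracleIterate, ih fun j hj => h j (hj.trans k.lt_succ_self)]
    simp only [h k k.lt_succ_self]

variable [MeasurableSpace Z]

theorem measurable_oracleIterate {G : Z → RVec d → RVec d}
    (hG : Measurable fun p : RVec d × Z => G p.2 p.1) (B : RVec d →L[ℝ] RVec d) (g x0 : RVec d)
    (k : ℕ) : Measurable fun ζ : ℕ → Fin m → Z => oracleIterate G B g x0 ζ k := by
  induction k with
  | zero => exact measurable_const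
  | succ k ih =>
    simp only [oracleIterate]
    have he : ∀ i : Fin m, Measurable fun ζ : ℕ → Fin m → Z => ζ k i := fun i =>
      (measurable_pi_apply i).comp (measurable_pi_apply k)
    have h1 : Measurable fun ζ : ℕ → Fin m → Z => ∑ i : Fin m,
        (G (ζ k i) (oracleIterate G B g x0 ζ k) - G (ζ k i) x0) :=
      Finset.measurable_fun_sum _ fun i _ =>
        (hG.comp (ih.prodMk (he i))).sub (hG.comp (measurable_const.prodMk (he i)))
    have h2 : Measurable fun ζ : ℕ → Fin m → Z => B ((1 / (m : ℝ)) • ∑ i : Fin m,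
        (G (ζ k i) (oracleIterate G B g x0 ζ k) - G (ζ k i) x0) + g) := by
      have h3 : Continuous fun v : RVec d => B ((1 / (m : ℝ)) • v + g) := by fun_prop
      exact h3.measurable.comp h1
    exact ih.sub h2

end Iterates

/-! ### Fresh batches and the union bound -/

section Probability

/-- A uniform bound on the sections of a set bounds its probability under independence. -/
theorem ProbabilityTheory.IndepFun.measureReal_mem_le {Ω α β : Type*} [MeasurableSpace Ω]
    [MeasurableSpace α] [MeasurableSpace β] {P : Measure Ω} [IsProbabilityMeasure P] {X : Ω → α}
    {Y : Ω → β} (h : IndepFun X Y P) (hX : AEMeasurable X P) (hY : AEMeasurable Y P)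
    {C : Set (α × β)} (hC : MeasurableSet C) {p : ℝ} (hp : 0 ≤ p)
    (hb : ∀ x, (P.map Y).real {y | (x, y) ∈ C} ≤ p) : P.real {ω | (X ω, Y ω) ∈ C} ≤ p := by
  have := Measure.isProbabilityMeasure_map hX
  have := Measure.isProbabilityMeasure_map hY
  refine ENNReal.toReal_le_of_le_ofReal hp ?_
  have h1 : P {ω | (X ω, Y ω) ∈ C} = (P.map fun ω => (X ω, Y ω)) C :=
    (Measure.map_apply_of_aemeasurable (hX.prodMk hY) hC).symm
  rw [h1, h.map_prod_eq_prod_map_map hX hY, Measure.prod_apply hC]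
  calc _ ≤ ∫⁻ _, ENNReal.ofReal p ∂(P.map X) := by
        refine lintegral_mono fun x => ?_
        rw [ENNReal.le_ofReal_iff_toReal_le (measure_ne_top _ _) hp]
        exact hb x
    _ = ENNReal.ofReal p := by simp

variable {d m : ℕ} {Z : Type*} [MeasurableSpace Z] {D : Measure Z}
  {Ω : Type*} [MeasurableSpace Ω] {P : Measure Ω} {ξ : ℕ → Fin m → Ω → Z}

theorem map_batch_eq_pi (hlaw : ∀ k i, HasLaw (ξ k i) D P)
    (hind : iIndepFun (fun p : ℕ × Fin m => ξ p.1 p.2) P) (k : ℕ) :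
    P.map (fun ω i => ξ k i ω) = Measure.pi fun _ => D := by
  have h1 : iIndepFun (fun i : Fin m => ξ k i) P :=
    hind.precomp (g := fun i : Fin m => (k, i)) (Prod.mk_right_injective k)
  rw [h1.map_fun_eq_pi_map fun i => (hlaw k i).aemeasurable]
  simp only [(hlaw k _).map_eq]

theorem indepFun_oracleIterate_batch [IsProbabilityMeasure D]
    (hlaw : ∀ k i, HasLaw (ξ k i) D P)
    (hind : iIndepFun (fun p : ℕ × Fin m => ξ p.1 p.2) P) {G : Z → RVec d → RVec d}
    (hG : Measurable fun p : RVec d × Z => G p.2 p.1) (B : RVec d →L[ℝ] RVec d) (g x0 : RVec d)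
    (k : ℕ) :
    IndepFun (fun ω => oracleIterate G B g x0 (fun j i => ξ j i ω) k) (fun ω i => ξ k i ω) P := by
  classical
  obtain ⟨z0⟩ : Nonempty Z := nonempty_of_isProbabilityMeasure D
  set S : Finset (ℕ × Fin m) := Finset.range k ×ˢ Finset.univ with hS
  set T : Finset (ℕ × Fin m) := {k} ×ˢ Finset.univ with hT
  have hST : Disjoint S T := by
    rw [Finset.disjoint_left]
    rintro ⟨j, i⟩ h1 h2
    simp only [hS, hT, Finset.mem_product, Finset.mem_range, Finset.mem_singleton,
      Finset.mem_univ, and_true] at h1 h2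
    omega
  have h1 := hind.indepFun_finset₀ S T hST fun p => (hlaw p.1 p.2).aemeasurable
  -- The iterate `k` reads only the batches before `k`, so filling the remaining coordinates with
  -- `z0` does not change it.
  have hφ : Measurable fun r : S → Z => oracleIterate G B g x0
      (fun j (i : Fin m) => if h : (j, i) ∈ S then r ⟨(j, i), h⟩ else z0) k := by
    refine (measurable_oracleIterate hG B g x0 k).comp
      (measurable_pi_lambda _ fun j => measurable_pi_lambda _ fun i => ?_)
    by_cases h : (j, i) ∈ S
    · simp only [h, dif_pos]
      exact measurable_pi_apply _
    · simp only [h, dif_neg, not_false_eq_true]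
      exact measurable_const
  have hχ : Measurable fun (r : T → Z) (i : Fin m) => r ⟨(k, i), by simp [hT]⟩ :=
    measurable_pi_lambda _ fun i => measurable_pi_apply _
  have h2 := h1.comp hφ hχ
  refine h2.congr (Filter.Eventually.of_forall fun ω => ?_) Filter.EventuallyEq.rfl
  refine oracleIterate_congr fun j hj i => ?_
  have : (j, i) ∈ S := by simp [hS, hj]
  simp [this]

/-- If from every point of `S` a mini-batch has large noise with probability at most `p`, then with
probability at least `1 - t p` none of the first `t` steps that start in `S` has large noise. -/
theorem one_sub_le_measureReal_of_noise_le [IsProbabilityMeasure D] [IsProbabilityMeasure P]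
    (hlaw : ∀ k i, HasLaw (ξ k i) D P)
    (hind : iIndepFun (fun p : ℕ × Fin m => ξ p.1 p.2) P) {ψ : Z → RVec d → ℝ}
    {G : Z → RVec d → RVec d} (hG : Measurable fun p : RVec d × Z => G p.2 p.1)
    (hψ : ∀ᵐ z ∂D, ∀ x, gradient (ψ z) x = G z x) {g : RVec d → RVec d} (hg : Measurable g)
    (B : RVec d →L[ℝ] RVec d) (x0 : RVec d) {S : Set (RVec d)} (hS : MeasurableSet S) {p τ : ℝ}
    (hp : 0 ≤ p) (hb : ∀ x ∈ S, (Measure.pi fun _ : Fin m => D).real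
      {z | τ < ‖∑ i, (G (z i) x - G (z i) x0 - (g x - g x0))‖} ≤ p) (t : ℕ) {Q : Set Ω}
    (hQ : ∀ ω, (∀ k < t, svrnIterate ψ B (g x0) x0 (fun j i => ξ j i ω) k ∈ S →
      ‖∑ i, (gradient (ψ (ξ k i ω)) (svrnIterate ψ B (g x0) x0 (fun j i => ξ j i ω) k)
        - gradient (ψ (ξ k i ω)) x0
        - (g (svrnIterate ψ B (g x0) x0 (fun j i => ξ j i ω) k) - g x0))‖ ≤ τ) → ω ∈ Q) :
    1 - t * p ≤ P.real Q := by
  have hae : ∀ᵐ ω ∂P, ∀ k i x, gradient (ψ (ξ k i ω)) x = G (ξ k i ω) x := by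
    rw [ae_all_iff]
    intro k
    rw [ae_all_iff]
    intro i
    have h1 := hψ
    rw [← (hlaw k i).map_eq] at h1
    exact ae_of_ae_map (hlaw k i).aemeasurable h1
  set x : ℕ → Ω → RVec d := fun k ω => oracleIterate G B (g x0) x0 (fun j i => ξ j i ω) k with hx
  set C : Set (RVec d × (Fin m → Z)) := {q | q.1 ∈ S ∧
    τ < ‖∑ i, (G (q.2 i) q.1 - G (q.2 i) x0 - (g q.1 - g x0))‖} with hC
  have hCm : MeasurableSet C := by
    refine MeasurableSet.inter (s₁ := Prod.fst ⁻¹' S) (s₂ := {q : RVec d × (Fin m → Z) |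
      τ < ‖∑ i, (G (q.2 i) q.1 - G (q.2 i) x0 - (g q.1 - g x0))‖}) (measurable_fst hS)
      (measurableSet_lt measurable_const ?_)
    refine (Finset.measurable_fun_sum _ fun i _ => ?_).norm
    have he : Measurable fun q : RVec d × (Fin m → Z) => q.2 i :=
      (measurable_pi_apply i).comp measurable_snd
    exact ((hG.comp (measurable_fst.prodMk he)).sub
      (hG.comp (measurable_const.prodMk he))).sub ((hg.comp measurable_fst).sub_const _)
  have hbad : ∀ k, P.real {ω | (x k ω, fun i => ξ k i ω) ∈ C} ≤ p := by
    intro k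
    have hξ : ∀ k i, AEMeasurable (ξ k i) P := fun k i => (hlaw k i).aemeasurable
    have hX : AEMeasurable (x k) P :=
      (measurable_oracleIterate hG B (g x0) x0 k).comp_aemeasurable
        (aemeasurable_pi_lambda _ fun j => aemeasurable_pi_lambda _ fun i => hξ j i)
    refine (indepFun_oracleIterate_batch hlaw hind hG B (g x0) x0 k).measureReal_mem_le hX
      (aemeasurable_pi_lambda _ fun i => hξ k i) hCm hp fun y => ?_
    rw [map_batch_eq_pi hlaw hind]
    by_cases hy : y ∈ S
    · simpa [hC, hy] using hb y hy
    · simpa [hC, hy] using hp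
  have hunion : P.real (⋃ k ∈ Finset.range t, {ω | (x k ω, fun i => ξ k i ω) ∈ C}) ≤ t * p := by
    refine (measureReal_biUnion_finset_le _ _).trans ?_
    refine (Finset.sum_le_sum fun k _ => hbad k).trans ?_
    simp
  set N : Set Ω := {ω | ¬ ∀ k i x, gradient (ψ (ξ k i ω)) x = G (ξ k i ω) x} with hN
  have hN0 : P.real N = 0 := by rw [measureReal_def, ae_iff.1 hae, ENNReal.toReal_zero]
  -- Subadditivity over this cover bounds the probability of `Q` from below without measurability of
  -- `Q`.
  have hcover : Set.univ ⊆
      (⋃ k ∈ Finset.range t, {ω | (x k ω, fun i => ξ k i ω) ∈ C}) ∪ N ∪ Q := by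
    intro ω _
    by_cases h1 : ω ∈ N
    · exact Or.inl (Or.inr h1)
    by_cases h2 : ω ∈ ⋃ k ∈ Finset.range t, {ω | (x k ω, fun i => ξ k i ω) ∈ C}
    · exact Or.inl (Or.inl h2)
    refine Or.inr (hQ ω fun k hk hkS => ?_)
    have h3 : ∀ k i x, gradient (ψ (ξ k i ω)) x = G (ξ k i ω) x := not_not.1 h1
    rw [svrnIterate_eq_oracleIterate (G := G) h3] at hkS ⊢
    by_contra hcon
    refine h2 (Set.mem_biUnion (Finset.mem_coe.2 (Finset.mem_range.2 hk)) ?_)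
    refine ⟨hkS, ?_⟩
    simp only [h3] at hcon
    exact not_le.1 hcon
  have h1 := measureReal_mono (μ := P) hcover
  rw [probReal_univ] at h1
  have h2 := measureReal_union_le (μ := P)
    ((⋃ k ∈ Finset.range t, {ω | (x k ω, fun i => ξ k i ω) ∈ C}) ∪ N) Q
  have h3 := measureReal_union_le (μ := P)
    (⋃ k ∈ Finset.range t, {ω | (x k ω, fun i => ξ k i ω) ∈ C}) N
  linarith

end Probability

/-! ### Noise of one mini-batch -/

section Noise

variable {d : ℕ} {Z : Type*} [MeasurableSpace Z] {D : Measure Z} [IsProbabilityMeasure D]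

theorem IsGradientOracle.norm_sub_le {lam : ℝ} (hlam : 0 < lam) {G : Z → RVec d → RVec d}
    {g : RVec d → RVec d} (hG : IsGradientOracle lam D G g) (x y : RVec d) :
    ‖g x - g y‖ ≤ lam * ‖x - y‖ := by
  rw [← hG.integral_eq, ← hG.integral_eq, ← integral_sub (hG.integrable x) (hG.integrable y)]
  have h := norm_integral_le_of_norm_le_const (μ := D)
    (ae_of_all _ fun z => norm_sub_le_of_cocoercive hlam (hG.cocoercive z x y))
  simpa using h

/-- The variance of a stochastic gradient difference is controlled by the mean gradients. -/
theorem IsGradientOracle.integral_norm_sq_le {lam : ℝ} {G : Z → RVec d → RVec d}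
    {g : RVec d → RVec d} (hG : IsGradientOracle lam D G g) (x y : RVec d) :
    ∫ z, ‖G z x - G z y - (g x - g y)‖ ^ 2 ∂D ≤ lam * inner ℝ (g x - g y) (x - y) := by
  set c := g x - g y with hc
  have hint : Integrable (fun z => G z x - G z y) D := (hG.integrable x).sub (hG.integrable y)
  have hmean : ∫ z, (G z x - G z y) ∂D = c := by
    rw [integral_sub (hG.integrable x) (hG.integrable y), hG.integral_eq, hG.integral_eq]
  have hrhs : Integrable (fun z => inner ℝ (lam • (x - y) - (2 : ℝ) • c) (G z x - G z y)
      + ‖c‖ ^ 2) D := (hint.const_inner _).add (integrable_const _)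
  -- Cocoercivity replaces the square of the gradient difference by a linear term, so the majorant
  -- is integrable without a second-moment assumption.
  have h1 : ∫ z, ‖G z x - G z y - c‖ ^ 2 ∂D ≤
      ∫ z, (inner ℝ (lam • (x - y) - (2 : ℝ) • c) (G z x - G z y) + ‖c‖ ^ 2) ∂D := by
    refine integral_mono_of_nonneg (ae_of_all _ fun z => sq_nonneg _) hrhs (ae_of_all _ fun z => ?_)
    have h2 := hG.cocoercive z x y
    simp only [norm_sub_sq_real (G z x - G z y) c, inner_sub_left (lam • (x - y)),
      inner_smul_left, conj_trivial]
    rw [real_inner_comm c, real_inner_comm (G z x - G z y) (x - y)]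
    linarith
  rw [integral_add (hint.const_inner _) (integrable_const _), integral_inner hint, hmean] at h1
  simp only [integral_const, probReal_univ, smul_eq_mul, one_mul, inner_sub_left (lam • (x - y)),
    inner_smul_left, conj_trivial, real_inner_self_eq_norm_sq] at h1
  rw [real_inner_comm]
  nlinarith [sq_nonneg ‖c‖]

/-- With high probability the noise of a mini-batch is small at all points that are at least as
close to `xs` as `x0`. -/
theorem IsGradientOracle.measureReal_noise_le {lam μ l Δ : ℝ} {m : ℕ} (hlam : 0 < lam)
    (hμ : 0 < μ) (hl : Real.log 2 ≤ l) (hm : 16 * (lam / μ * l) ≤ m) {G : Z → RVec d → RVec d}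
    {g : RVec d → RVec d} (hG : IsGradientOracle lam D G g) {A : RVec d →L[ℝ] RVec d}
    (hs : ∀ u v, inner ℝ (A u) v = inner ℝ u (A v)) (hA : ∀ v, μ * ‖v‖ ^ 2 ≤ inner ℝ v (A v))
    {xs x0 x : RVec d} (hx0 : normWrt A (x0 - xs) ≤ Δ) (hx : normWrt A (x - xs) ≤ Δ)
    (hm0 : ∀ v, |inner ℝ v (g x0 - A (x0 - xs))| ≤ 3 / 8 * normWrt A v * normWrt A (x0 - xs))
    (hmx : ∀ v, |inner ℝ v (g x - A (x - xs))| ≤ 3 / 8 * normWrt A v * normWrt A (x - xs)) :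
    (Measure.pi fun _ : Fin m => D).real
      {z | 8 * √(m * lam * l) * Δ < ‖∑ i, (G (z i) x - G (z i) x0 - (g x - g x0))‖} ≤
      Real.exp (-l) := by
  have hA0 : ∀ v, 0 ≤ inner ℝ v (A v) := fun v =>
    (mul_nonneg hμ.le (sq_nonneg _)).trans (hA v)
  have hl0 : 0 < l := (Real.log_pos (by norm_num)).trans_le hl
  have hm' : (0 : ℝ) < m := lt_of_lt_of_le (by positivity) hm
  have hΔ : 0 ≤ Δ := (normWrt_nonneg _ _).trans hx
  have hu : normWrt A (x - x0) ≤ 2 * Δ := by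
    have h1 := normWrt_add_le hs hA0 (x - xs) (xs - x0)
    rw [sub_add_sub_cancel, normWrt_sub_comm A xs] at h1
    linarith
  have hμs : 0 < √μ := Real.sqrt_pos.2 hμ
  have hun : ‖x - x0‖ ≤ 2 * Δ / √μ := by
    rw [le_div_iff₀ hμs, mul_comm]
    exact (mul_norm_le_normWrt hA _).trans hu
  rcases hΔ.eq_or_lt with hΔ0 | hΔ0
  · have h1 : x = x0 := by
      rw [← hΔ0] at hun
      simpa [sub_eq_zero] using hun
    subst h1
    simp [← hΔ0, Real.exp_nonneg]
  -- `11/2 = 4 + 2 · (3/8) · 2`: the squared `A`-distance of `x` and `x0` plus two model errors.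
  have hgu : inner ℝ (g x - g x0) (x - x0) ≤ 11 / 2 * Δ ^ 2 := by
    have h1 := (abs_le.1 (hmx (x - x0))).2
    have h2 := (abs_le.1 (hm0 (x - x0))).1
    have h3 : inner ℝ (x - x0) (A (x - xs)) - inner ℝ (x - x0) (A (x0 - xs)) =
        normWrt A (x - x0) ^ 2 := by
      rw [← inner_sub_right, ← map_sub, sub_sub_sub_cancel_right, normWrt_sq hA0]
    rw [inner_sub_right] at h1 h2
    rw [real_inner_comm, inner_sub_right]
    have hn := normWrt_nonneg A (x - x0)
    have h4 := mul_le_mul hu hx (normWrt_nonneg _ _) (by positivity)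
    have h5 := mul_le_mul hu hx0 (normWrt_nonneg _ _) (by positivity)
    have h6 := mul_le_mul hu hu (normWrt_nonneg _ _) (by positivity)
    nlinarith
  set X : Z → RVec d := fun z => G z x - G z x0 - (g x - g x0) with hX
  have hmeas : ∀ y, Measurable fun z => G z y := fun y =>
    hG.measurable.comp (measurable_const.prodMk measurable_id)
  have hXm : Measurable X := ((hmeas x).sub (hmeas x0)).sub_const _
  have hXb : ∀ z, ‖X z‖ ≤ 4 * lam * Δ / √μ := by
    intro z
    have h1 := norm_sub_le_of_cocoercive hlam (hG.cocoercive z x x0)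
    have h2 := hG.norm_sub_le hlam x x0
    have h3 := mul_le_mul_of_nonneg_left hun hlam.le
    calc ‖X z‖ ≤ ‖G z x - G z x0‖ + ‖g x - g x0‖ := _root_.norm_sub_le _ _
      _ ≤ lam * (2 * Δ / √μ) + lam * (2 * Δ / √μ) := by linarith
      _ = _ := by ring
  have hX0 : ∫ z, X z ∂D = 0 := by
    have h1 : ∫ z, X z ∂D = ∫ z, (G z x - G z x0) ∂D - ∫ _, (g x - g x0) ∂D :=
      integral_sub ((hG.integrable x).sub (hG.integrable x0)) (integrable_const _)
    rw [h1, integral_sub (hG.integrable x) (hG.integrable x0), hG.integral_eq, hG.integral_eq]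
    simp
  have hXV : ∫ z, ‖X z‖ ^ 2 ∂D ≤ 11 / 2 * lam * Δ ^ 2 := by
    refine (hG.integral_norm_sq_le x x0).trans ?_
    have := mul_le_mul_of_nonneg_left hgu hlam.le
    linarith
  -- With this `θ`, `θ R ≤ 1` amounts to `16 κ l ≤ m`, and the tail exponent is `11/2 l - 8 l`; the
  -- factor `2 ≤ exp l` is then absorbed.
  set θ := √(l / (m * lam)) / Δ with hθ
  have hθ0 : 0 ≤ θ := by positivity
  have hθR : θ * (4 * lam * Δ / √μ) ≤ 1 := by
    have h1 : θ * (4 * lam * Δ / √μ) = 4 * lam * √(l / (m * lam)) / √μ := by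
      rw [hθ]; field_simp
    rw [h1, div_le_one hμs]
    refine le_of_sq_le_sq ?_ hμs.le
    rw [mul_pow, Real.sq_sqrt (by positivity), Real.sq_sqrt hμ.le]
    have h2 : (4 * lam) ^ 2 * (l / (m * lam)) = 16 * (lam / μ * l) / m * μ := by
      field_simp
      norm_num
    rw [h2]
    exact mul_le_of_le_one_left hμ.le ((div_le_one hm').2 hm)
  have hmain := measureReal_norm_sum_ge_le hXm hXb hX0 hXV hθ0 hθR m (8 * √(m * lam * l) * Δ)
  have he1 : (m : ℝ) * (θ ^ 2 * (11 / 2 * lam * Δ ^ 2)) = 11 / 2 * l := by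
    rw [hθ, div_pow, Real.sq_sqrt (by positivity)]
    field_simp
  have he2 : θ * (8 * √(m * lam * l) * Δ) = 8 * l := by
    have h1 : √(l / (m * lam)) * √(m * lam * l) = l := by
      rw [← Real.sqrt_mul (by positivity)]
      have : l / (m * lam) * (m * lam * l) = l ^ 2 := by field_simp
      rw [this, Real.sqrt_sq hl0.le]
    calc _ = 8 * (√(l / (m * lam)) * √(m * lam * l)) := by rw [hθ]; field_simp
      _ = _ := by rw [h1]
  rw [he1, he2] at hmain
  refine ((measureReal_mono fun z hz => ?_).trans hmain).trans ?_
  · have hz' : 8 * √(m * lam * l) * Δ < ‖∑ i, X (z i)‖ := hz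
    exact hz'.le
  · have h1 : (2 : ℝ) ≤ Real.exp l := (Real.log_le_iff_le_exp (by norm_num)).1 hl
    calc 2 * Real.exp (11 / 2 * l - 8 * l) ≤ Real.exp l * Real.exp (11 / 2 * l - 8 * l) :=
          mul_le_mul_of_nonneg_right h1 (Real.exp_pos _).le
      _ = Real.exp (-(3 / 2 * l)) := by rw [← Real.exp_add]; ring_nf
      _ ≤ Real.exp (-l) := Real.exp_le_exp.2 (by linarith)

end Noise

/-! ### Contraction of the iterates and function gaps -/

section Convergence

variable {d : ℕ}

/-- `A` is within the factor `1 ± ε` of `H`, and on the `H`-ball around `xs` with radius determined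
by `K` and `M` the gradient `g` is close to its linear model with Hessian `A`. -/
structure IsLocalModel (ε K M : ℝ) (H A : RVec d →L[ℝ] RVec d) (g : RVec d → RVec d)
    (xs : RVec d) : Prop where
  lower : ∀ v, (1 - ε) * inner ℝ v (H v) ≤ inner ℝ v (A v)
  upper : ∀ v, inner ℝ v (A v) ≤ (1 + ε) * inner ℝ v (H v)
  gradient_linear : ∀ x, K * normWrt H (x - xs) < ε * M → ∀ v,
    |inner ℝ v (g x - A (x - xs))| ≤ 3 / 2 * ε * normWrt A v * normWrt A (x - xs)

variable {ε K M μ : ℝ} {H A B : RVec d →L[ℝ] RVec d} {g : RVec d → RVec d} {xs : RVec d}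

theorem IsLocalModel.gradient_le (h : IsLocalModel ε K M H A g xs) (hε4 : ε ≤ 1 / 4)
    {x : RVec d} (hx : K * normWrt H (x - xs) < ε * M) (v : RVec d) :
    |inner ℝ v (g x - A (x - xs))| ≤ 3 / 8 * normWrt A v * normWrt A (x - xs) := by
  refine (h.gradient_linear x hx v).trans ?_
  have h1 := normWrt_nonneg A v
  have h2 := normWrt_nonneg A (x - xs)
  gcongr
  linarith

/-- Changing norms on both sides costs `√((1 + ε)/(1 - ε)) ≤ √(5/3) < 13/10`. -/
theorem IsLocalModel.normWrt_le (h : IsLocalModel ε K M H A g xs) (hε : 0 < ε) (hε4 : ε ≤ 1 / 4)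
    (hH : ∀ v, 0 ≤ inner ℝ v (H v)) (hA : ∀ v, 0 ≤ inner ℝ v (A v)) {γ : ℝ} (hγ : 0 ≤ γ)
    {v w : RVec d} (hvw : normWrt A v ≤ γ * normWrt A w) :
    normWrt H v ≤ 13 / 10 * γ * normWrt H w := by
  refine le_of_sq_le_sq ?_ (mul_nonneg (by positivity) (normWrt_nonneg _ _))
  have h1 := pow_le_pow_left₀ (normWrt_nonneg _ _) hvw 2
  rw [mul_pow, normWrt_sq hA, normWrt_sq hA] at h1
  rw [mul_pow, normWrt_sq hH, normWrt_sq hH]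
  have h2 := h.lower v
  have h3 := mul_le_mul_of_nonneg_left (h.upper w) (sq_nonneg γ)
  have h4 := hH v
  have h5 := mul_nonneg (sq_nonneg γ) (hH w)
  nlinarith

/-- The linear-plus-noise convergence of inexact Newton steps in a local model. -/
theorem IsLocalModel.iterate_le (h : IsLocalModel ε K M H A g xs) (hK : 0 ≤ K) (hε : 0 < ε)
    (hε4 : ε ≤ 1 / 4) (hμ : 0 < μ) (hH : ∀ v, 0 ≤ inner ℝ v (H v))
    (hs : ∀ u v, inner ℝ (A u) v = inner ℝ u (A v)) (hA : ∀ v, μ * ‖v‖ ^ 2 ≤ inner ℝ v (A v))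
    (hB : IsInverseApprox ε A B) {η : ℝ} (hη : 0 ≤ η) (hη1 : η ≤ 1 / 200) {t : ℕ}
    {x e : ℕ → RVec d} (hx0 : K * normWrt H (x 0 - xs) < ε * M)
    (hx : ∀ k, x (k + 1) = x k - B (g (x k) + e k))
    (he : ∀ k < t, normWrt A (x k - xs) ≤ normWrt A (x 0 - xs) →
      K * normWrt H (x k - xs) < ε * M → ‖e k‖ ≤ √μ * (8 * η * normWrt A (x 0 - xs))) :
    ∀ k ≤ t, normWrt A (x k - xs) ≤ normWrt A (x 0 - xs) ∧ K * normWrt H (x k - xs) < ε * M ∧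
      normWrt A (x k - xs) ≤ ((3 * ε) ^ k + 40 * η) * normWrt A (x 0 - xs) := by
  have hA0 : ∀ v, 0 ≤ inner ℝ v (A v) := fun v =>
    (mul_nonneg hμ.le (sq_nonneg _)).trans (hA v)
  have hΔ := normWrt_nonneg A (x 0 - xs)
  intro k
  induction k with
  | zero =>
    intro _
    refine ⟨le_rfl, hx0, ?_⟩
    rw [pow_zero]
    nlinarith
  | succ k ih =>
    intro hk
    obtain ⟨h1, h2, h3⟩ := ih (by omega)
    have hek := he k hk h1 h2
    set Δ := normWrt A (x 0 - xs) with hΔdef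
    have hNk := normWrt_nonneg A (x k - xs)
    -- For `ε ≤ 1/4`, `ε + (1 + ε) · 3ε/2 ≤ 23/8 ε` and `(1 + ε) · 8 ≤ 10`.
    have hstep : normWrt A (x (k + 1) - xs) ≤
        23 / 8 * ε * normWrt A (x k - xs) + 10 * η * Δ := by
      have h4 := normWrt_newton_step_le hμ hε hs hA hB (x k - xs)
        ((g (x k) - A (x k - xs)) + e k)
        (b := 3 / 2 * ε * normWrt A (x k - xs) + 8 * η * Δ) (by positivity) (fun v => by
          have h5 := h.gradient_linear _ h2 v
          have h6 : |inner ℝ v (e k)| ≤ 8 * η * Δ * normWrt A v := by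
            refine (abs_real_inner_le_norm _ _).trans ?_
            have h7 := mul_norm_le_normWrt hA v
            have h8 := mul_le_mul_of_nonneg_left hek (norm_nonneg v)
            have h9 := mul_le_mul_of_nonneg_right h7 (by positivity : 0 ≤ 8 * η * Δ)
            linarith
          rw [inner_add_right]
          refine (abs_add_le _ _).trans ?_
          linarith)
      have h5 : x (k + 1) - xs = x k - xs - B (A (x k - xs) + ((g (x k) - A (x k - xs)) + e k)) := by
        rw [hx, ← add_assoc, add_sub_cancel]
        abel
      rw [h5]
      refine h4.trans ?_
      have h6 : ε * (ε * normWrt A (x k - xs)) ≤ 1 / 4 * (ε * normWrt A (x k - xs)) :=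
        mul_le_mul_of_nonneg_right hε4 (by positivity)
      have h7 : ε * (η * Δ) ≤ 1 / 4 * (η * Δ) := mul_le_mul_of_nonneg_right hε4 (by positivity)
      nlinarith
    -- `23/32 + 10/200 < 769/1000`, and `13/10 · 769/1000 < 1`, so the `H`-norm stays below its
    -- initial value too and the iterate does not leave the neighborhood.
    have hγ : normWrt A (x (k + 1) - xs) ≤ 769 / 1000 * Δ := by
      have h6 : ε * normWrt A (x k - xs) ≤ 1 / 4 * Δ := mul_le_mul hε4 h1 hNk (by norm_num)
      have h7 := mul_le_mul_of_nonneg_right hη1 hΔ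
      linarith
    refine ⟨hγ.trans (by linarith), ?_, ?_⟩
    · have h6 := h.normWrt_le hε hε4 hH hA0 (by norm_num) hγ
      have h7 : normWrt H (x (k + 1) - xs) ≤ normWrt H (x 0 - xs) :=
        h6.trans (mul_le_of_le_one_left (normWrt_nonneg _ _) (by norm_num))
      exact (mul_le_mul_of_nonneg_left h7 hK).trans_lt hx0
    -- The constant `40` is stable under the recursion: `23/32 · 40 + 10 ≤ 40`.
    · have h6 := mul_le_mul_of_nonneg_left h3 hε.le
      have h7 : ε * (η * Δ) ≤ 1 / 4 * (η * Δ) := mul_le_mul_of_nonneg_right hε4 (by positivity)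
      have h8 : 0 ≤ ε * ((3 * ε) ^ k * Δ) := by positivity
      have h9 : 0 ≤ η * Δ := by positivity
      rw [pow_succ]
      nlinarith

/-- In a local model the function value gap is comparable to the squared `A`-norm. -/
theorem IsLocalModel.value_gap {f : RVec d → ℝ} (h : IsLocalModel ε K M H A (gradient f) xs)
    (hK : 0 ≤ K) (hε4 : ε ≤ 1 / 4) (hμ : 0 < μ) (hsc : IsStronglyConvex μ f)
    (hxs : IsMinOn f Set.univ xs) (hA0 : ∀ v, 0 ≤ inner ℝ v (A v)) {x : RVec d}
    (hx : K * normWrt H (x - xs) < ε * M) :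
    f x - f xs ≤ 11 / 8 * normWrt A (x - xs) ^ 2 ∧
      5 / 32 * normWrt A (x - xs) ^ 2 ≤ f x - f xs := by
  constructor
  · have h1 := hsc xs x
    have h2 := (abs_le.1 (h.gradient_le hε4 hx (x - xs))).2
    rw [inner_sub_right, ← normWrt_sq hA0, real_inner_comm] at h2
    rw [← neg_sub x xs, inner_neg_right, norm_neg] at h1
    have h3 : 0 ≤ μ / 2 * ‖x - xs‖ ^ 2 := by positivity
    nlinarith
  -- At the midpoint `f` is already at least `f xs`; the gradient there supplies `(1 - 3/8) · 1/4 =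
  -- 5/32`.
  · set u := (1 / 2 : ℝ) • (x - xs) with hu
    have hy : K * normWrt H (xs + u - xs) < ε * M := by
      rw [add_sub_cancel_left, hu, normWrt_smul _ (by norm_num)]
      have := mul_nonneg hK (normWrt_nonneg H (x - xs))
      linarith
    have h1 := hsc x (xs + u)
    have h2 := (abs_le.1 (h.gradient_le hε4 hy u)).1
    have h3 : x - (xs + u) = u := by rw [hu]; module
    rw [h3] at h1
    rw [add_sub_cancel_left, inner_sub_right, ← normWrt_sq hA0, real_inner_comm] at h2
    have h4 : f xs ≤ f (xs + u) := hxs (Set.mem_univ _)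
    have h5 : normWrt A u = 1 / 2 * normWrt A (x - xs) := normWrt_smul _ (by norm_num) _
    have h6 : 0 ≤ μ / 2 * ‖u‖ ^ 2 := by positivity
    rw [h5] at h2
    nlinarith

end Convergence

/-! ### Assembly of the theorem -/

/-- Both kinds of neighborhoods are balls on which a local model is available. -/
theorem exists_isLocalModel {d : ℕ} {f : RVec d → ℝ} {μ : ℝ} (hμ : 0 < μ) (hf : ContDiff ℝ 2 f)
    (hsc : IsStronglyConvex μ f) {xs : RVec d} (hxs : gradient f xs = 0) {U : ℝ → Set (RVec d)}
    (hU : (IsSelfConcordant f ∧ U = nbhdSelfConcordant f xs) ∨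
      (∃ L : ℝ, 0 ≤ L ∧ HasLipschitzHessian L f ∧ U = nbhdLipschitz μ L f xs)) :
    ∃ K M : ℝ, 0 ≤ K ∧ 0 < M ∧
      (∀ δ x, x ∈ U δ ↔ K * normWrt (hess f xs) (x - xs) < δ * M) ∧
      ∀ ε, 0 < ε → ε ≤ 1 / 4 → ∀ xt ∈ U ε,
        IsLocalModel ε K M (hess f xs) (hess f xt) (gradient f) xs := by
  rcases hU with ⟨hsf, rfl⟩ | ⟨L, hL, hlip, rfl⟩
  · have hmem : ∀ δ x, x ∈ nbhdSelfConcordant f xs δ ↔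
        1 * normWrt (hess f xs) (x - xs) < δ * (1 / 4) := by
      intro δ x
      rw [one_mul, mul_one_div]
      rfl
    refine ⟨1, 1 / 4, zero_le_one, by norm_num, hmem, fun ε hε hε4 xt hxt => ?_⟩
    obtain ⟨h1, h2⟩ := local_model_of_isSelfConcordant hμ hsc hsf hxs hε hε4 hxt
    exact ⟨fun v => (h1 v).1, fun v => (h1 v).2, fun x hx => h2 x ((hmem ε x).2 hx)⟩
  · refine ⟨L, μ ^ (3 / 2 : ℝ), hL, Real.rpow_pos_of_pos hμ _, fun _ _ => Iff.rfl,
      fun ε hε hε4 xt hxt => ?_⟩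
    obtain ⟨h1, h2⟩ := local_model_of_hasLipschitzHessian hμ hsc hf hL hlip hxs hxt
    exact ⟨fun v => (h1 v).1, fun v => (h1 v).2, fun x hx => h2 x hx⟩

theorem pow_le_of_log_div_log_le {κ ε m : ℝ} {t : ℕ} (hκ : 0 < κ) (hm : 0 < m) (hε : 0 < ε)
    (hε4 : ε ≤ 1 / 4) (h : Real.log (m / κ) / Real.log (1 / (3 * ε)) ≤ t) :
    (3 * ε) ^ t ≤ κ / m := by
  have h1 : 0 < Real.log (1 / (3 * ε)) := by
    apply Real.log_pos
    rw [lt_div_iff₀ (by positivity)]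
    linarith
  rw [div_le_iff₀ h1, ← Real.log_pow, Real.log_le_log_iff (by positivity) (by positivity),
    div_pow, one_pow, div_le_div_iff₀ hκ (by positivity)] at h
  rw [le_div_iff₀ hm]
  linarith

theorem theorem1 :
    ∃ c : ℝ, 0 < c ∧
    ∀ (d : ℕ)
      -- the distribution of the random convex function `ψ`, and its expectation `f`
      (Z : Type*) [MeasurableSpace Z] (D : Measure Z) [IsProbabilityMeasure D]
      (ψ : Z → RVec d → ℝ) (f : RVec d → ℝ) (μ lam : ℝ),
      0 < μ → 0 < lam →
      (∀ᵐ z ∂D, ConvexOn ℝ Set.univ (ψ z)) →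
      (∀ x, Integrable (fun z => ψ z x) D) →
      (∀ x, f x = ∫ z, ψ z x ∂D) →
      ContDiff ℝ 2 f →
      IsStronglyConvex μ f →
      (∀ᵐ z ∂D, IsSmooth lam (ψ z)) →
    -- the minimizer of `f` and its local neighborhoods `U ε`
    ∀ (xs : RVec d), IsMinOn f Set.univ xs →
    ∀ (U : ℝ → Set (RVec d)),
      ((IsSelfConcordant f ∧ U = nbhdSelfConcordant f xs) ∨
        (∃ L : ℝ, 0 ≤ L ∧ HasLipschitzHessian L f ∧ U = nbhdLipschitz μ L f xs)) →
    ∀ (εH : ℝ), 0 < εH → εH ≤ 1 / 4 →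
      U εH ∈ 𝓝 xs ∧
      ∀ (xt : RVec d), xt ∈ U εH →
      ∀ (B : RVec d →L[ℝ] RVec d), IsInverseApprox εH (hess f xt) B →
      ∀ (δ : ℝ) (m t : ℕ), 0 < δ → δ < 1 → 1 ≤ t → 2 * δ ≤ (t : ℝ) →
        Real.log (m / (lam / μ)) / Real.log (1 / (3 * εH)) ≤ (t : ℝ) →
        c * (lam / μ) * Real.log (t / δ) ≤ (m : ℝ) →
      -- the samples: independent with distribution `D`, a fresh mini-batch in every step
      ∀ (Ω : Type*) [MeasurableSpace Ω] (P : Measure Ω) [IsProbabilityMeasure P]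
        (ξ : ℕ → Fin m → Ω → Z),
        (∀ k i, HasLaw (ξ k i) D P) →
        iIndepFun (fun p : ℕ × Fin m => ξ p.1 p.2) P →
        let ρ : ℝ := c * Real.log (t / δ) * ((lam / μ) / m)
        let xnew : Ω → RVec d :=
          fun ω => svrnIterate ψ B (gradient f xt) xt (fun k i => ξ k i ω) t
        1 - δ ≤ P.real {ω | f (xnew ω) - f xs ≤ ρ * (f xt - f xs) ∧
          xnew ω ∈ U (Real.sqrt ρ * εH)} := by
  -- `40000 = 200²`: the condition on `m` becomes `η ≤ 1/200`, and `√ρ = 200 η`.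
  refine ⟨40000, by norm_num, ?_⟩
  intro d Z _ D _ ψ f μ lam hμ hlam hconv hint hfint hf hsc hsm xs hxs U hU ε hε hε4
  have hgrad := gradient_eq_zero_of_isMinOn hxs
  obtain ⟨K, M, hK, hM, hmem, hmodel⟩ := exists_isLocalModel hμ hf hsc hgrad hU
  refine ⟨?_, ?_⟩
  · have h1 : U ε = {x | K * normWrt (hess f xs) (x - xs) < ε * M} := Set.ext fun x => hmem ε x
    rw [h1]
    refine (isOpen_lt ?_ continuous_const).mem_nhds ?_
    · exact continuous_const.mul ((continuous_normWrt _).comp (continuous_id.sub continuous_const))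
    · have : K * normWrt (hess f xs) (xs - xs) < ε * M := by
        rw [sub_self, normWrt_zero, mul_zero]
        positivity
      exact this
  intro xt hxt B hB δ m t hδ hδ1 ht htδ htlog hmc Ω _ P _ ξ hlaw hind ρ xnew
  set H := hess f xs with hHdef
  set A := hess f xt with hAdef
  have hmod := hmodel ε hε hε4 xt hxt
  have hH0 : ∀ v, 0 ≤ inner ℝ v (H v) := fun v =>
    (mul_nonneg hμ.le (sq_nonneg _)).trans (hess_coercive hf hsc xs v)
  have hA := hess_coercive hf hsc xt
  have hA0 : ∀ v, 0 ≤ inner ℝ v (A v) := fun v => (mul_nonneg hμ.le (sq_nonneg _)).trans (hA v)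
  have hAs := hess_symm hf xt
  rw [← hAdef] at hA hAs
  have hxt' := (hmem ε xt).1 hxt
  set l := Real.log (t / δ) with hl
  have ht0 : (0 : ℝ) < t := by exact_mod_cast ht
  have hl2 : Real.log 2 ≤ l :=
    Real.log_le_log (by norm_num) ((le_div_iff₀ hδ).2 htδ)
  have hl0 : 0 < l := (Real.log_pos (by norm_num)).trans_le hl2
  have hκ : 0 < lam / μ := div_pos hlam hμ
  have hm0 : (0 : ℝ) < m := lt_of_lt_of_le (by positivity) hmc
  obtain ⟨G, hG, hGψ⟩ := exists_isGradientOracle hlam hconv hint hfint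
    (hf.differentiable (by norm_num)) hsm
  have hgcont : Continuous (gradient f) :=
    continuous_iff_continuousAt.2 fun x => (hasFDerivAt_gradient hf x).continuousAt
  set Δ := normWrt A (xt - xs) with hΔ
  have hΔ0 : 0 ≤ Δ := normWrt_nonneg _ _
  set S : Set (RVec d) := {x | normWrt A (x - xs) ≤ Δ ∧ K * normWrt H (x - xs) < ε * M} with hS
  have hSm : MeasurableSet S := by
    have hc : ∀ T : RVec d →L[ℝ] RVec d, Continuous fun x => normWrt T (x - xs) := fun T =>
      (continuous_normWrt T).comp (continuous_id.sub continuous_const)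
    exact MeasurableSet.inter (s₁ := {x | normWrt A (x - xs) ≤ Δ})
      (s₂ := {x | K * normWrt H (x - xs) < ε * M})
      (isClosed_le (hc A) continuous_const).measurableSet
      (isOpen_lt (continuous_const.mul (hc H)) continuous_const).measurableSet
  have hexp : Real.exp (-l) = δ / t := by
    rw [Real.exp_neg, hl, Real.exp_log (by positivity), inv_div]
  set η := √(lam / μ * l / m) with hη
  have hη0 : 0 ≤ η := Real.sqrt_nonneg _
  have hηsq : η ^ 2 = lam / μ * l / m := Real.sq_sqrt (by positivity)
  have hη1 : η ≤ 1 / 200 := by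
    refine Real.sqrt_le_iff.2 ⟨by norm_num, ?_⟩
    rw [div_le_iff₀ hm0]
    linarith
  have hρη : ρ = (200 * η) ^ 2 := by
    rw [mul_pow, hηsq]
    simp only [ρ]
    ring
  have hηpos : 0 < η := Real.sqrt_pos.2 (by positivity)
  have hsqρ : √ρ = 200 * η := by rw [hρη, Real.sqrt_sq (by positivity)]
  have hnoise : 8 * √(m * lam * l) * Δ = m * (√μ * (8 * η * Δ)) := by
    have h1 : √(m * lam * l) = m * (√μ * η) := by
      rw [hη, ← Real.sqrt_mul hμ.le, ← Real.sqrt_sq hm0.le, ← Real.sqrt_mul (by positivity),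
        Real.sqrt_sq hm0.le]
      congr 1
      field_simp
    rw [h1]; ring
  -- `κ/m = η²/l`, and `η ≤ 1/200 < log 2 ≤ l`.
  have hpow : (3 * ε) ^ t ≤ η := by
    refine (pow_le_of_log_div_log_le hκ hm0 hε hε4 htlog).trans ?_
    have h1 : lam / μ / m = η ^ 2 / l := by rw [hηsq]; field_simp
    rw [h1, div_le_iff₀ hl0, sq]
    have h2 : (0.69 : ℝ) < Real.log 2 := lt_trans (by norm_num) Real.log_two_gt_d9
    exact mul_le_mul_of_nonneg_left (by linarith) hη0
  have hmain := one_sub_le_measureReal_of_noise_le hlaw hind hG.measurable hGψ hgcont.measurable B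
    xt hSm (p := δ / t) (τ := 8 * √(m * lam * l) * Δ) (by positivity) (fun x hx => by
      rw [← hexp]
      refine hG.measureReal_noise_le hlam hμ hl2 (by linarith) hAs hA le_rfl hx.1
        (hmod.gradient_le hε4 hxt') (hmod.gradient_le hε4 hx.2)) t
    (Q := {ω | f (xnew ω) - f xs ≤ ρ * (f xt - f xs) ∧ xnew ω ∈ U (√ρ * ε)}) (fun ω hω => ?_)
  · rwa [mul_div_cancel₀ _ ht0.ne'] at hmain
  set x : ℕ → RVec d := fun k => svrnIterate ψ B (gradient f xt) xt (fun j i => ξ j i ω) k with hx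
  set e : ℕ → RVec d := fun k => (1 / (m : ℝ)) • ∑ i, (gradient (ψ (ξ k i ω)) (x k)
    - gradient (ψ (ξ k i ω)) xt - (gradient f (x k) - gradient f xt)) with he
  have hrec : ∀ k, x (k + 1) = x k - B (gradient f (x k) + e k) := by
    intro k
    have h1 : x (k + 1) = x k - B ((1 / (m : ℝ)) • ∑ i, (gradient (ψ (ξ k i ω)) (x k)
      - gradient (ψ (ξ k i ω)) xt) + gradient f xt) := rfl
    rw [h1, he]
    simp only
    rw [Finset.sum_sub_distrib _ (fun _ => gradient f (x k) - gradient f xt), Finset.sum_const,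
      Finset.card_univ, Fintype.card_fin, smul_sub, ← Nat.cast_smul_eq_nsmul ℝ, smul_smul,
      one_div_mul_cancel hm0.ne', one_smul]
    congr 2
    abel
  have hiter := hmod.iterate_le hK hε hε4 hμ hH0 hAs hA hB hη0 hη1 (t := t) (x := x) (e := e)
    hxt' hrec (fun k hk h1 h2 => by
      have h3 := hω k hk ⟨h1, h2⟩
      rw [hnoise] at h3
      rw [he]
      simp only
      rw [norm_smul, Real.norm_eq_abs, abs_of_pos (by positivity), one_div,
        inv_mul_le_iff₀ hm0]
      exact h3) t le_rfl
  obtain ⟨-, h2, h3⟩ := hiter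
  have hx0 : x 0 = xt := rfl
  have hxt1 : x t = xnew ω := rfl
  rw [hx0, hxt1, ← hΔ] at h3
  rw [hxt1] at h2
  -- The factor `41` leaves room for both claims: `11/8 · 32/5 · 41² ≤ 200²` for the function gap
  -- and `13/10 · 41 ≤ 200` for the neighborhood.
  have h4 : normWrt A (xnew ω - xs) ≤ 41 * η * Δ := by
    refine h3.trans (mul_le_mul_of_nonneg_right ?_ hΔ0)
    linarith
  refine ⟨?_, ?_⟩
  · have h5 := (hmod.value_gap hK hε4 hμ hsc hxs hA0 h2).1
    have h6 := (hmod.value_gap hK hε4 hμ hsc hxs hA0 hxt').2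
    have h7 := pow_le_pow_left₀ (normWrt_nonneg _ _) h4 2
    have h8 := mul_le_mul_of_nonneg_left h6 (sq_nonneg η)
    rw [hρη]
    rw [← hΔ] at h8
    have h9 : 0 ≤ η ^ 2 * Δ ^ 2 := by positivity
    linarith
  · rw [hmem, hsqρ]
    have h5 := hmod.normWrt_le hε hε4 hH0 hA0 (by positivity) h4
    have h6 := mul_le_mul_of_nonneg_left h5 hK
    have h7 := mul_lt_mul_of_pos_left hxt' hηpos
    have h8 : 0 ≤ η * (K * normWrt H (xt - xs)) :=
      mul_nonneg hη0 (mul_nonneg hK (normWrt_nonneg _ _))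
    linarith
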